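/- **Proposition.** Consider the discrete-time Poisson channel with input $X\in[0,\infty)$, output $Y\in\{0,1,2,\dots\}$ and transition law $$P_{Y|X}(y|x)=\frac{1}{y!}\,x^y e^{-x}\qquad(0^0=1).$$ For $\mathsf A>0$ let $C(\mathsf A)=\max_{X:\,0\le X\le \mathsf A} I(X;Y)$ be its capacity under the amplitude constraint $0\le X\le\mathsf A$, let $P_{X^\star}$ (depending on $\mathsf A$) be a capacity-achieving input distribution, i.e. a law on $[0,\mathsf A]$ with $I(X^\star;Y^\star)=C(\mathsf A)$, where $Y^\star$ is the channel output for the input $X^\star\sim P_{X^\star}$. Let $\hat X$ be a maximum a posteriori decoder, $$\hat X(y)\in\operatorname*{arg\,max}_{x\in\operatorname{supp}(P_{X^\star})}P_{X^\star|Y^\star}(x|y),$$ and let $P_e=\mathbb P[X^\star\neq\hat X(Y^\star)]$ be its error probability. Let $H(X^\star|Y^\star)=\mathbb E\left[-\log P_{X^\star|Y^\star}(X^\star|Y^\star)\right]$ be the equivocation (natural logarithm). Then $$\liminf_{\mathsf A\to\infty}P_e\;\ge\;1-\sqrt{\frac{2}{\pi}},\qquad\qquad \liminf_{\mathsf A\to\infty}H(X^\star|Y^\star)\;\ge\;2\left(1-\sqrt{\frac{2}{\pi}}\right).$$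 -/

import Mathlib

open MeasureTheory ProbabilityTheory InformationTheory
open scoped NNReal ENNReal

namespace PoissonChannel

/-- The Poisson channel `P_{Y|X}(y|x) = x ^ y * exp (-x) / y !` with input alphabet `[0, ∞)`
and output alphabet `{0, 1, 2, …}`. -/
noncomputable def channel : Kernel ℝ≥0 ℕ where
  toFun x := poissonMeasure x
  measurable' := by
    refine Measure.measurable_of_measurable_coe _ fun s _ => ?_
    simp only [poissonMeasure, Measure.sum_apply_of_countable, Measure.smul_apply, smul_eq_mul]
    refine Measurable.tsum fun n => Measurable.mul_const ?_ _
    exact ENNReal.measurable_ofReal.comp (by fun_prop)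

instance : IsMarkovKernel channel := ⟨fun x => by
  change IsProbabilityMeasure (poissonMeasure x)
  infer_instance⟩

/-- The joint law of `(X, Y)` when the input `X` has law `P` and `Y` is the channel output. -/
noncomputable def joint (P : Measure ℝ≥0) : Measure (ℝ≥0 × ℕ) := P ⊗ₘ channel

/-- The law of the output `Y` when the input `X` has law `P`. -/
noncomputable def output (P : Measure ℝ≥0) : Measure ℕ := (joint P).map Prod.snd

/-- The mutual information `I(X;Y) = D(P_{XY} ‖ P_X × P_Y)`, in nats. -/
noncomputable def mutualInformation (P : Measure ℝ≥0) : ℝ≥0∞ :=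
  klDiv (joint P) (P.prod (output P))

/-- `P` is the law of a random variable `X` with `0 ≤ X ≤ A` almost surely. -/
structure IsAdmissible (A : ℝ≥0) (P : Measure ℝ≥0) : Prop where
  isProbabilityMeasure : IsProbabilityMeasure P
  le_amplitude : ∀ᵐ x ∂P, x ≤ A

/-- The capacity `C(A)`: the supremum of `I(X;Y)` over all inputs with `0 ≤ X ≤ A`. -/
noncomputable def capacity (A : ℝ≥0) : ℝ≥0∞ :=
  ⨆ (P : Measure ℝ≥0) (_ : IsAdmissible A P), mutualInformation P

/-- `P` is a capacity-achieving input law for the amplitude constraint `A`. -/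
structure IsCapacityAchieving (A : ℝ≥0) (P : Measure ℝ≥0) : Prop where
  admissible : IsAdmissible A P
  mutualInformation_eq : mutualInformation P = capacity A

/-- The posterior probability `P_{X|Y}(x|y) = ℙ[X = x | Y = y]` for the input law `P`. -/
noncomputable def posteriorProb (P : Measure ℝ≥0) (x : ℝ≥0) (y : ℕ) : ℝ≥0∞ :=
  cond (joint P) (Prod.snd ⁻¹' {y}) (Prod.fst ⁻¹' {x})

/-- `Xhat` is a maximum a posteriori decoder of `X` from `Y` for the input law `P`: for every
output `y`, `Xhat y` maximizes `P_{X|Y}(x|y)` over the points `x` of the support of `P`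
(ties are broken arbitrarily). -/
def IsMAPDecoder (P : Measure ℝ≥0) (Xhat : ℕ → ℝ≥0) : Prop :=
  ∀ y : ℕ, Xhat y ∈ P.support ∧ ∀ x ∈ P.support, posteriorProb P x y ≤ posteriorProb P (Xhat y) y

/-- The error probability `ℙ[X ≠ Xhat(Y)]` of the decoder `Xhat` for the input law `P`. -/
noncomputable def errorProb (P : Measure ℝ≥0) (Xhat : ℕ → ℝ≥0) : ℝ≥0∞ :=
  joint P {p | p.1 ≠ Xhat p.2}

/-- The equivocation `H(X|Y) = 𝔼[- log P_{X|Y}(X|Y)]`, in nats, for the input law `P`. For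
discrete `P` this is `∑ y, P_Y(y) ∑ x, - P_{X|Y}(x|y) log P_{X|Y}(x|y)`. -/
noncomputable def equivocation (P : Measure ℝ≥0) : ℝ≥0∞ :=
  ∫⁻ p, (- ENNReal.log (posteriorProb P p.1 p.2)).toENNReal ∂(joint P)

end PoissonChannel

/-! Write W(y|x) for the transition law. Everything follows from one estimate,
`eventually_exists_bound`: for every c > 2/3 and A large, ∑ y, max over x of P{x} W(y|x) is at most
c for every capacity-achieving P. This sum bounds the probability that any decoder is correct
(`one_sub_le_errorProb`) and also the mean posterior probability of the true input, so by convexity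
of -log the equivocation is at least -log c (`neg_log_le_equivocation`). Since 1/3 > 1 - √(2/π) and
log(3/2) > 2(1 - √(2/π)), both claims follow.

The estimate has two ingredients. The first is that the optimal output law is nearly the smooth law
F(y) = 1/(2√(A(y+1))) on y < A. By Stirling's formula, the expectation of log(W/w) for w(y) =
1/(2√(y+1)) tends to the same constant log √(2/(πe)) for all large inputs
(`tendsto_integral_log_weight_sub`). An input with nearly uniform square root therefore gives I(X;Y)
≥ log √A + constant - o(1) (`eventually_le_capacity`), while a suitable reference law Q satisfies
D(W(·|x)‖Q) ≤ log √A + constant + o(1) for all x ≤ A (`eventually_klDiv_poisson_le`). The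
compensation identity `klDiv_joint_prod_eq_add` forces D(P_Y‖Q) to be small, hence P_Y is close to F
in total variation (`eventually_tsum_abs_output_sub_le`).

The second is that a locally flat output law admits no heavy posterior atom. Put v(x) = (x/y)^j with
j of order √A. Multiplying W(y|x) by v^i turns it into a multiple of W(y + ij|x), so for T = pv + q
+ r/v the integral of W(y|·)T² against P is a combination of five output probabilities. Replacing
P_Y by F, this is F(y) times the second moment of T under a log-normal law with moments a^(i²), a =
exp(j²/(2y)). If T = 1 at the atom x, that integral bounds P{x} W(y|x). Minimizing over T gives the
Christoffel function, at most (a²+1)/(a²+2) (`exists_test_polynomial`), which tends to 2/3 as a → 1.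
Summing over y, with total variation paying for the replacement and a thin edge region treated
crudely, gives the estimate. -/

namespace PoissonChannel

/-! ### Expectations under Poisson laws -/

/-- The transition probability `P_{Y|X}(y|x)` as a real number. -/
noncomputable def weight (x : ℝ≥0) (y : ℕ) : ℝ := Real.exp (-x) * (x : ℝ) ^ y / y.factorial

lemma weight_nonneg (x : ℝ≥0) (y : ℕ) : 0 ≤ weight x y := by unfold weight; positivity

lemma weight_pos {x : ℝ≥0} (hx : 0 < x) (y : ℕ) : 0 < weight x y := by
  have : (0 : ℝ) < x := hx
  unfold weight; positivity

lemma poissonMeasure_singleton_eq (x : ℝ≥0) (y : ℕ) :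
    poissonMeasure x {y} = ENNReal.ofReal (weight x y) :=
  poissonMeasure_singleton x y

lemma weight_le_one (x : ℝ≥0) (y : ℕ) : weight x y ≤ 1 := by
  have h := prob_le_one (μ := poissonMeasure x) (s := {y})
  rwa [poissonMeasure_singleton_eq, ENNReal.ofReal_le_one] at h

lemma integral_poisson_eq_tsum (x : ℝ≥0) (g : ℕ → ℝ) :
    ∫ y, g y ∂(poissonMeasure x) = ∑' y, weight x y * g y := by
  rw [integral_poissonMeasure]; rfl

lemma integrable_exp_poisson (x : ℝ≥0) (C : ℝ) :
    Integrable (fun y : ℕ => C * Real.exp y) (poissonMeasure x) := by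
  refine Integrable.const_mul ?_ C
  rw [integrable_poissonMeasure_iff]
  have h := (NormedSpace.expSeries_div_summable (𝔸 := ℝ) (x * Real.exp 1)).mul_left
    (Real.exp (-x))
  refine h.congr fun n => ?_
  rw [Real.norm_of_nonneg (Real.exp_pos _).le, mul_pow, ← Real.exp_nat_mul, mul_one]
  ring

lemma integrable_poisson_of_abs_le (x : ℝ≥0) {g : ℕ → ℝ} {C : ℝ}
    (hg : ∀ y, |g y| ≤ C * Real.exp y) : Integrable g (poissonMeasure x) :=
  (integrable_exp_poisson x C).mono' Measurable.of_discrete.aestronglyMeasurable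
    (Filter.Eventually.of_forall hg)

lemma pow_le_mul_exp (y : ℕ) (k : ℕ) : (y : ℝ) ^ k ≤ k.factorial * Real.exp y := by
  have h := Real.pow_div_factorial_le_exp (y : ℝ) (Nat.cast_nonneg y) k
  rwa [div_le_iff₀' (by positivity)] at h

lemma integrable_pow_poisson (x : ℝ≥0) (k : ℕ) :
    Integrable (fun y : ℕ => (y : ℝ) ^ k) (poissonMeasure x) :=
  integrable_poisson_of_abs_le x fun y => by
    rw [abs_of_nonneg (by positivity)]; exact pow_le_mul_exp y k

lemma integrable_cast_poisson (x : ℝ≥0) :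
    Integrable (fun y : ℕ => (y : ℝ)) (poissonMeasure x) := by
  simpa using integrable_pow_poisson x 1

/-- Index shift: y W(y|x) = x W(y-1|x). This single identity produces every Poisson moment used
below. -/
lemma integral_nat_mul_poisson (x : ℝ≥0) (g : ℕ → ℝ) :
    ∫ y, (y : ℝ) * g y ∂(poissonMeasure x) = x * ∫ y, g (y + 1) ∂(poissonMeasure x) := by
  rw [integral_poisson_eq_tsum, integral_poisson_eq_tsum, ← tsum_mul_left]
  rw [← (add_left_injective 1).tsum_eq (f := fun y => weight x y * ((y : ℝ) * g y))]
  · refine tsum_congr fun y => ?_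
    simp only [weight, Nat.factorial_succ]
    push_cast
    field_simp
    ring
  · intro y hy
    rcases y with _ | y
    · simp at hy
    · exact ⟨y, rfl⟩

lemma integral_cast_poisson (x : ℝ≥0) : ∫ y, (y : ℝ) ∂(poissonMeasure x) = x := by
  simpa using integral_nat_mul_poisson x fun _ => 1

lemma integral_pow_two_poisson (x : ℝ≥0) :
    ∫ y, (y : ℝ) ^ 2 ∂(poissonMeasure x) = x ^ 2 + x := by
  have h := integral_nat_mul_poisson x fun y => y
  simp_rw [← pow_two] at h
  rw [h]
  push_cast
  rw [integral_add (integrable_cast_poisson x) (integrable_const _), integral_cast_poisson]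
  simp; ring

lemma integral_pow_three_poisson (x : ℝ≥0) :
    ∫ y, (y : ℝ) ^ 3 ∂(poissonMeasure x) = x ^ 3 + 3 * x ^ 2 + x := by
  have h := integral_nat_mul_poisson x fun y => y ^ 2
  have e : ∀ y : ℕ, (y : ℝ) * y ^ 2 = y ^ 3 := fun y => by ring
  simp_rw [e] at h
  have e2 : ∀ y : ℕ, ((y + 1 : ℕ) : ℝ) ^ 2 = y ^ 2 + (2 * y + 1) := fun y => by push_cast; ring
  simp_rw [e2] at h
  have i1 := integrable_cast_poisson x
  have i2 := integrable_pow_poisson x 2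
  rw [h, integral_add i2 ((i1.const_mul 2).fun_add (integrable_const _)),
    integral_add (i1.const_mul 2) (integrable_const _), integral_const_mul,
    integral_cast_poisson, integral_pow_two_poisson]
  simp; ring

lemma integral_pow_four_poisson (x : ℝ≥0) :
    ∫ y, (y : ℝ) ^ 4 ∂(poissonMeasure x) = x ^ 4 + 6 * x ^ 3 + 7 * x ^ 2 + x := by
  have h := integral_nat_mul_poisson x fun y => y ^ 3
  have e : ∀ y : ℕ, (y : ℝ) * y ^ 3 = y ^ 4 := fun y => by ring
  simp_rw [e] at h
  have e2 : ∀ y : ℕ, ((y + 1 : ℕ) : ℝ) ^ 3 = y ^ 3 + (3 * y ^ 2 + (3 * y + 1)) :=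
    fun y => by push_cast; ring
  simp_rw [e2] at h
  have i1 := integrable_cast_poisson x
  have i2 := integrable_pow_poisson x 2
  have i3 := integrable_pow_poisson x 3
  have j1 := (i1.const_mul 3).fun_add (integrable_const (1 : ℝ))
  have j2 := (i2.const_mul 3).fun_add j1
  rw [h, integral_add i3 j2, integral_add (i2.const_mul 3) j1,
    integral_add (i1.const_mul 3) (integrable_const _), integral_const_mul, integral_const_mul,
    integral_cast_poisson, integral_pow_two_poisson, integral_pow_three_poisson]
  simp; ring

/-- Expectation of a polynomial of degree four under a Poisson law. -/
lemma integral_quartic_poisson (x : ℝ≥0) (a b c d e : ℝ) :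
    ∫ y, (a + b * (y : ℝ) + c * (y : ℝ) ^ 2 + d * (y : ℝ) ^ 3 + e * (y : ℝ) ^ 4)
      ∂(poissonMeasure x) =
    a + b * x + c * (x ^ 2 + x) + d * (x ^ 3 + 3 * x ^ 2 + x)
      + e * (x ^ 4 + 6 * x ^ 3 + 7 * x ^ 2 + x) := by
  have i1 := (integrable_cast_poisson x).const_mul b
  have i2 := (integrable_pow_poisson x 2).const_mul c
  have i3 := (integrable_pow_poisson x 3).const_mul d
  have i4 := (integrable_pow_poisson x 4).const_mul e
  have i0 : Integrable (fun _ : ℕ => a) (poissonMeasure x) := integrable_const a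
  rw [integral_add (((i0.fun_add i1).fun_add i2).fun_add i3) i4,
    integral_add ((i0.fun_add i1).fun_add i2) i3, integral_add (i0.fun_add i1) i2, integral_add i0 i1, integral_const_mul, integral_const_mul,
    integral_const_mul, integral_const_mul, integral_cast_poisson, integral_pow_two_poisson,
    integral_pow_three_poisson, integral_pow_four_poisson]
  simp

lemma integrable_quartic_poisson (x : ℝ≥0) (a b c d e : ℝ) :
    Integrable (fun y : ℕ =>
      a + b * (y : ℝ) + c * (y : ℝ) ^ 2 + d * (y : ℝ) ^ 3 + e * (y : ℝ) ^ 4)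
      (poissonMeasure x) :=
  (((((integrable_const a).add ((integrable_cast_poisson x).const_mul b))).add
    ((integrable_pow_poisson x 2).const_mul c)).add
    ((integrable_pow_poisson x 3).const_mul d)).add ((integrable_pow_poisson x 4).const_mul e)

lemma integrable_sq_sub_poisson (x : ℝ≥0) :
    Integrable (fun y : ℕ => ((y : ℝ) - x) ^ 2) (poissonMeasure x) := by
  refine (integrable_quartic_poisson x ((x : ℝ) ^ 2) (-2 * x) 1 0 0).congr
    (Filter.Eventually.of_forall fun y => ?_)
  simp only; ring

/-- The variance of a Poisson law. -/
lemma integral_sq_sub_poisson (x : ℝ≥0) :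
    ∫ y, ((y : ℝ) - x) ^ 2 ∂(poissonMeasure x) = x := by
  have h := integral_quartic_poisson x ((x : ℝ) ^ 2) (-2 * x) 1 0 0
  calc _ = _ := integral_congr_ae (Filter.Eventually.of_forall fun y => by ring)
    _ = _ := h
    _ = x := by ring

lemma integrable_inv_succ_poisson (x : ℝ≥0) :
    Integrable (fun y : ℕ => ((y : ℝ) + 1)⁻¹) (poissonMeasure x) :=
  integrable_poisson_of_abs_le (C := 1) x fun y => by
    rw [abs_of_nonneg (by positivity), one_mul]
    calc ((y : ℝ) + 1)⁻¹ ≤ 1 := inv_le_one_of_one_le₀ (by linarith [y.cast_nonneg (α := ℝ)])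
      _ ≤ _ := Real.one_le_exp (by positivity)

/-- The shift identity with g(y) = 1/y: its left integrand is the indicator of y ≠ 0. -/
lemma integral_inv_succ_poisson_le {x : ℝ≥0} (hx : 0 < x) :
    ∫ y, ((y : ℝ) + 1)⁻¹ ∂(poissonMeasure x) ≤ (x : ℝ)⁻¹ := by
  have h := integral_nat_mul_poisson x fun y => (y : ℝ)⁻¹
  have h1 : ∫ y, (y : ℝ) * (y : ℝ)⁻¹ ∂(poissonMeasure x) ≤ 1 := by
    have hle : ∀ y : ℕ, (y : ℝ) * (y : ℝ)⁻¹ ≤ 1 := fun y => mul_inv_le_one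
    calc _ ≤ ∫ _, (1 : ℝ) ∂(poissonMeasure x) := by
          refine integral_mono (integrable_poisson_of_abs_le (C := 1) x fun y => ?_)
            (integrable_const _) hle
          rw [abs_of_nonneg (by positivity), one_mul]
          exact (hle y).trans (Real.one_le_exp (by positivity))
      _ = 1 := by simp
  push_cast at h
  rw [h] at h1
  have hx' : (0 : ℝ) < x := hx
  rwa [← one_div, le_div_iff₀' hx']

end PoissonChannel

namespace PoissonChannel

/-! ### The relative entropy of a Poisson law to the weight `1 / (2 √(y + 1))` -/

/-- The difference of the two sides vanishes at 0 and has derivative t³/(1+t), which has the sign of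
t. -/
lemma log_one_add_le_cubic {w : ℝ} (hw : -1 < w) :
    Real.log (1 + w) ≤ w - w ^ 2 / 2 + w ^ 3 / 3 := by
  let k : ℝ → ℝ := fun t => t - t ^ 2 / 2 + t ^ 3 / 3 - Real.log (1 + t)
  have hk : ∀ t : ℝ, -1 < t → HasDerivAt k (t ^ 3 / (1 + t)) t := by
    intro t ht
    have h1 : HasDerivAt (fun t : ℝ => Real.log (1 + t)) (1 / (1 + t)) t :=
      ((hasDerivAt_id t).const_add 1).log (by simp; linarith)
    have h2 : HasDerivAt (fun t : ℝ => t - t ^ 2 / 2 + t ^ 3 / 3) (1 - t + t ^ 2) t := by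
      have := ((hasDerivAt_id t).sub (((hasDerivAt_id t).pow 2).div_const 2)).add
        (((hasDerivAt_id t).pow 3).div_const 3)
      refine this.congr_deriv ?_
      simp
    refine (h2.sub h1).congr_deriv ?_
    field_simp [show (1 + t) ≠ 0 by linarith]
    ring
  have hk0 : k 0 = 0 := by simp [k]
  have hmain : k 0 ≤ k w := by
    rcases le_total 0 w with h | h
    · refine monotoneOn_of_deriv_nonneg (convex_Ici (0 : ℝ))
        (fun t ht => (hk t (by simp at ht; linarith)).continuousAt.continuousWithinAt)
        (fun t ht => (hk t (by simp at ht; linarith)).differentiableAt.differentiableWithinAt)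
        (fun t ht => ?_) (by simp) h h
      simp only [interior_Ici, Set.mem_Ioi] at ht
      rw [(hk t (by linarith)).deriv]
      positivity
    · refine antitoneOn_of_deriv_nonpos (convex_Ioc (-1 : ℝ) 0)
        (fun t ht => (hk t ht.1).continuousAt.continuousWithinAt)
        (fun t ht => ?_) (fun t ht => ?_) ⟨hw, h⟩ (by simp) h
      all_goals simp only [interior_Ioc, Set.mem_Ioo] at ht
      · exact (hk t ht.1).differentiableAt.differentiableWithinAt
      · rw [(hk t ht.1).deriv]
        exact div_nonpos_of_nonpos_of_nonneg (Odd.pow_nonpos (by decide) ht.2.le) (by linarith)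
  have : 0 ≤ k w := hk0 ▸ hmain
  simp only [k] at this
  linarith

lemma mul_log_le_quartic {z : ℝ} (hz : 0 ≤ z) :
    z * Real.log z ≤ (z - 1) + (z - 1) ^ 2 / 2 - (z - 1) ^ 3 / 6 + (z - 1) ^ 4 / 3 := by
  rcases hz.eq_or_lt with rfl | h
  · norm_num
  have := log_one_add_le_cubic (w := z - 1) (by linarith)
  rw [add_sub_cancel] at this
  calc z * Real.log z ≤ z * _ := mul_le_mul_of_nonneg_left this hz
    _ = _ := by ring

/-- The difference vanishes at 1 together with its derivative, and its second derivative is (t-1)²/t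
≥ 0. Continuity of t log t covers z = 0. -/
lemma cubic_le_mul_log {z : ℝ} (hz : 0 ≤ z) :
    (z - 1) + (z - 1) ^ 2 / 2 - (z - 1) ^ 3 / 6 ≤ z * Real.log z := by
  let k : ℝ → ℝ := fun t => t * Real.log t - ((t - 1) + (t - 1) ^ 2 / 2 - (t - 1) ^ 3 / 6)
  let k' : ℝ → ℝ := fun t => Real.log t - (t - 1) + (t - 1) ^ 2 / 2
  have hk : ∀ t : ℝ, 0 < t → HasDerivAt k (k' t) t := by
    intro t ht
    have h1 := Real.hasDerivAt_mul_log ht.ne'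
    have h0 := (hasDerivAt_id t).sub_const 1
    have h2 := (h0.add ((h0.pow 2).div_const 2)).sub ((h0.pow 3).div_const 6)
    refine (h1.sub h2).congr_deriv ?_
    simp [k']; ring
  have hk2 : ∀ t : ℝ, 0 < t → HasDerivAt k' ((t - 1) ^ 2 / t) t := by
    intro t ht
    have h1 := Real.hasDerivAt_log ht.ne'
    have h0 := (hasDerivAt_id t).sub_const 1
    have h2 := (h1.sub h0).add ((h0.pow 2).div_const 2)
    refine h2.congr_deriv ?_
    simp; field_simp; ring
  have hmono : MonotoneOn k' (Set.Ioi 0) := by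
    refine monotoneOn_of_deriv_nonneg (convex_Ioi 0)
      (fun t ht => (hk2 t ht).continuousAt.continuousWithinAt)
      (fun t ht => ?_) (fun t ht => ?_)
    all_goals simp only [interior_Ioi, Set.mem_Ioi] at ht
    · exact (hk2 t ht).differentiableAt.differentiableWithinAt
    · rw [(hk2 t ht).deriv]; positivity
  have hk1 : k 1 = 0 := by simp [k]
  have hk'1 : k' 1 = 0 := by simp [k']
  have hcont : Continuous k := by
    have := Real.continuous_mul_log
    fun_prop
  have hmain : k 1 ≤ k z := by
    rcases le_total 1 z with h | h
    · refine monotoneOn_of_deriv_nonneg (convex_Ici (1 : ℝ)) hcont.continuousOn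
        (fun t ht => ?_) (fun t ht => ?_) (by simp) h h
      all_goals simp only [interior_Ici, Set.mem_Ioi] at ht
      · exact (hk t (by linarith)).differentiableAt.differentiableWithinAt
      · rw [(hk t (by linarith)).deriv, ← hk'1]
        exact hmono (by simp) (by simp; linarith) ht.le
    · refine antitoneOn_of_deriv_nonpos (convex_Icc (0 : ℝ) 1) hcont.continuousOn
        (fun t ht => ?_) (fun t ht => ?_) ⟨hz, h⟩ (by simp) h
      all_goals simp only [interior_Icc, Set.mem_Ioo] at ht
      · exact (hk t ht.1).differentiableAt.differentiableWithinAt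
      · rw [(hk t ht.1).deriv, ← hk'1]
        exact hmono ht.1 (by simp) ht.2.le
  have : 0 ≤ k z := hk1 ▸ hmain
  simp only [k] at this
  linarith

lemma abs_mul_log_cast_le (y : ℕ) : |(y : ℝ) * Real.log y| ≤ 2 * Real.exp y := by
  rw [abs_of_nonneg (mul_nonneg y.cast_nonneg (Real.log_natCast_nonneg y))]
  calc (y : ℝ) * Real.log y ≤ y * y :=
        mul_le_mul_of_nonneg_left (Real.log_le_self y.cast_nonneg) y.cast_nonneg
    _ ≤ _ := by simpa [pow_two] using pow_le_mul_exp y 2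

lemma integrable_mul_log_poisson (x : ℝ≥0) :
    Integrable (fun y : ℕ => (y : ℝ) * Real.log y) (poissonMeasure x) :=
  integrable_poisson_of_abs_le x abs_mul_log_cast_le

/-- The deviation of `y log y` from `y log x`, in terms of `z = y / x`. -/
lemma mul_log_div_eq {x : ℝ} (hx : 0 < x) (y : ℕ) :
    x * ((y / x) * Real.log (y / x)) = y * Real.log y - y * Real.log x := by
  rcases y.eq_zero_or_pos with rfl | hy
  · simp
  rw [Real.log_div (by positivity) hx.ne']
  field_simp

lemma integral_mul_log_poisson_eq {x : ℝ≥0} (hx : 0 < x) :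
    ∫ y, (y : ℝ) * Real.log y ∂(poissonMeasure x) - x * Real.log x =
      ∫ y : ℕ, (x : ℝ) * ((y / x) * Real.log (y / x)) ∂(poissonMeasure x) := by
  have hx' : (0 : ℝ) < x := hx
  simp_rw [mul_log_div_eq hx']
  rw [integral_sub (integrable_mul_log_poisson x) ((integrable_cast_poisson x).mul_const _),
    integral_mul_const, integral_cast_poisson]

lemma integrable_mul_log_div_poisson {x : ℝ≥0} (hx : 0 < x) :
    Integrable (fun y : ℕ => (x : ℝ) * ((y / x) * Real.log (y / x))) (poissonMeasure x) := by
  have hx' : (0 : ℝ) < x := hx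
  simp_rw [mul_log_div_eq hx']
  exact (integrable_mul_log_poisson x).sub ((integrable_cast_poisson x).mul_const _)

/-- With z = y/x, the quadratic Taylor term of x · z log z has mean exactly 1/2, because the
variance is x. The cubic and quartic terms contribute O(1/x). -/
lemma integral_mul_log_poisson_le {x : ℝ≥0} (hx : 1 ≤ x) :
    ∫ y, (y : ℝ) * Real.log y ∂(poissonMeasure x) - x * Real.log x ≤ 1 / 2 + 2 / x := by
  have hx1 : (1 : ℝ) ≤ x := hx
  have hx0 : 0 < x := lt_of_lt_of_le one_pos hx
  have hx' : (0 : ℝ) < x := hx0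
  rw [integral_mul_log_poisson_eq hx0]
  set a : ℝ := x * (-1 + 1 / 2 + 1 / 6 + 1 / 3)
  set b : ℝ := 1 - 1 - 1 / 2 - 4 / 3
  set c : ℝ := (1 / 2 + 1 / 2 + 2) / x
  set d : ℝ := (-1 / 6 - 4 / 3) / x ^ 2
  set e : ℝ := 1 / 3 / x ^ 3
  calc _ ≤ ∫ y : ℕ, (a + b * (y : ℝ) + c * (y : ℝ) ^ 2 + d * (y : ℝ) ^ 3 + e * (y : ℝ) ^ 4)
        ∂(poissonMeasure x) := by
        refine integral_mono (integrable_mul_log_div_poisson hx0)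
          (integrable_quartic_poisson x a b c d e) fun y => ?_
        have h := mul_log_le_quartic (z := (y : ℝ) / x) (by positivity)
        refine (mul_le_mul_of_nonneg_left h hx'.le).trans (le_of_eq ?_)
        simp only [a, b, c, d, e]
        field_simp
        ring
    _ = 1 / 2 - 1 / (6 * x) + 1 / x + 1 / (3 * x ^ 2) := by
        rw [integral_quartic_poisson]
        simp only [a, b, c, d, e]
        field_simp
        ring
    _ ≤ 1 / 2 + 2 / x := by
        have h1 : 1 / (3 * (x : ℝ) ^ 2) ≤ 1 / x :=
          one_div_le_one_div_of_le hx' (by nlinarith)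
        have h2 : 0 ≤ 1 / (6 * (x : ℝ)) := by positivity
        have h3 : 2 / (x : ℝ) = 1 / x + 1 / x := by ring
        linarith

lemma le_integral_mul_log_poisson {x : ℝ≥0} (hx : 0 < x) :
    1 / 2 - 1 / (6 * x) ≤ ∫ y, (y : ℝ) * Real.log y ∂(poissonMeasure x) - x * Real.log x := by
  have hx' : (0 : ℝ) < x := hx
  rw [integral_mul_log_poisson_eq hx]
  set a : ℝ := x * (-1 + 1 / 2 + 1 / 6)
  set b : ℝ := 1 - 1 - 1 / 2
  set c : ℝ := (1 / 2 + 1 / 2) / x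
  set d : ℝ := (-1 / 6) / x ^ 2
  calc _ = ∫ y : ℕ, (a + b * (y : ℝ) + c * (y : ℝ) ^ 2 + d * (y : ℝ) ^ 3 + 0 * (y : ℝ) ^ 4)
        ∂(poissonMeasure x) := by
        rw [integral_quartic_poisson]
        simp only [a, b, c, d]
        field_simp
        ring
    _ ≤ _ := by
        refine integral_mono (integrable_quartic_poisson x a b c d 0)
          (integrable_mul_log_div_poisson hx) fun y => ?_
        have h := cubic_le_mul_log (z := (y : ℝ) / x) (by positivity)
        refine le_trans (le_of_eq ?_) (mul_le_mul_of_nonneg_left h hx'.le)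
        simp only [a, b, c, d]
        field_simp
        ring

end PoissonChannel

/-! ### Stirling's formula and the limiting divergence from the weights 1/(2√(y+1)) -/

namespace PoissonChannel

/-- The unnormalized output weight `1 / (2 √(y + 1))` of an input with uniform square root. -/
noncomputable def refWeight (y : ℕ) : ℝ := 1 / (2 * √((y : ℝ) + 1))

lemma refWeight_pos (y : ℕ) : 0 < refWeight y := by unfold refWeight; positivity

lemma log_refWeight (y : ℕ) :
    Real.log (refWeight y) = -(Real.log 2 + Real.log ((y : ℝ) + 1) / 2) := by
  rw [refWeight, one_div, Real.log_inv, Real.log_mul (by norm_num) (by positivity),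
    Real.log_sqrt (by positivity)]

/-- The error term of Stirling's formula for `(y + 1)!`. -/
noncomputable def stirlingError (y : ℕ) : ℝ :=
  Real.log (Stirling.stirlingSeq (y + 1)) - Real.log √Real.pi

lemma stirlingError_nonneg (y : ℕ) : 0 ≤ stirlingError y :=
  sub_nonneg.2 (Real.log_le_log (by positivity) (Stirling.sqrt_pi_le_stirlingSeq y.succ_ne_zero))

lemma stirlingError_antitone : Antitone stirlingError := fun _ _ h =>
  sub_le_sub_right (Stirling.log_stirlingSeq'_antitone h) _

lemma tendsto_stirlingError : Filter.Tendsto stirlingError Filter.atTop (nhds 0) := by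
  have h := ((Real.continuousAt_log (by positivity : √Real.pi ≠ 0)).tendsto.comp
    (Stirling.tendsto_stirlingSeq_sqrt_pi.comp (Filter.tendsto_add_atTop_nat 1))).sub_const
      (Real.log √Real.pi)
  rwa [sub_self] at h

lemma abs_stirlingError_le (y : ℕ) : |stirlingError y| ≤ stirlingError 0 * Real.exp y := by
  rw [abs_of_nonneg (stirlingError_nonneg y)]
  exact (stirlingError_antitone (Nat.zero_le y)).trans
    (le_mul_of_one_le_right (stirlingError_nonneg 0) (Real.one_le_exp y.cast_nonneg))

lemma integrable_stirlingError (x : ℝ≥0) : Integrable stirlingError (poissonMeasure x) :=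
  integrable_poisson_of_abs_le x abs_stirlingError_le

lemma tendsto_inv_coe_nnreal :
    Filter.Tendsto (fun x : ℝ≥0 => (x : ℝ)⁻¹) Filter.atTop (nhds 0) :=
  tendsto_inv_atTop_zero.comp (NNReal.tendsto_coe_atTop.2 Filter.tendsto_id)

/-- The error is below ε/2 from some n on; for y < n it is at most its value at 0 times n/(y+1),
whose mean is O(1/x). -/
lemma tendsto_integral_stirlingError :
    Filter.Tendsto (fun x : ℝ≥0 => ∫ y, stirlingError y ∂(poissonMeasure x)) Filter.atTop
      (nhds 0) := by
  rw [Metric.tendsto_nhds]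
  intro ε hε
  obtain ⟨n, hn⟩ := Filter.eventually_atTop.1
    (tendsto_stirlingError.eventually (gt_mem_nhds (half_pos hε)))
  have h1 : Filter.Tendsto (fun x : ℝ≥0 => ε / 2 + stirlingError 0 * n * (x : ℝ)⁻¹) Filter.atTop
      (nhds (ε / 2)) := by
    simpa using (tendsto_inv_coe_nnreal.const_mul (stirlingError 0 * n)).const_add (ε / 2)
  filter_upwards [h1.eventually (gt_mem_nhds (half_lt_self hε)), Filter.eventually_gt_atTop 0]
    with x hx hx0
  rw [Real.dist_eq, sub_zero, abs_of_nonneg (integral_nonneg stirlingError_nonneg)]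
  refine lt_of_le_of_lt ?_ hx
  have hi := (integrable_inv_succ_poisson x).const_mul (stirlingError 0 * n)
  calc _ ≤ ∫ y : ℕ, (ε / 2 + stirlingError 0 * n * ((y : ℝ) + 1)⁻¹) ∂(poissonMeasure x) := by
        refine integral_mono (integrable_stirlingError x) ((integrable_const _).add hi)
          fun y => ?_
        have h0 := stirlingError_nonneg 0
        rcases le_or_gt n y with h | h
        · have := (hn y h).le
          have : 0 ≤ stirlingError 0 * n * ((y : ℝ) + 1)⁻¹ := by positivity
          simp only; linarith
        · have h2 : 1 ≤ (n : ℝ) * ((y : ℝ) + 1)⁻¹ := by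
            rw [← div_eq_mul_inv, one_le_div (by positivity)]
            exact_mod_cast h
          have h3 := stirlingError_antitone (Nat.zero_le y)
          have h4 := mul_le_mul_of_nonneg_left h2 h0
          simp only; linarith
    _ ≤ _ := by
        rw [integral_add (integrable_const _) hi, integral_const_mul]
        have := integral_inv_succ_poisson_le hx0
        have h0 := stirlingError_nonneg 0
        simp only [integral_const, probReal_univ, one_smul]
        gcongr

lemma log_weight {x : ℝ≥0} (hx : 0 < x) (y : ℕ) :
    Real.log (weight x y) = y * Real.log x - x - Real.log y.factorial := by
  have : (0 : ℝ) < x := hx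
  rw [weight, Real.log_div (by positivity) (by positivity),
    Real.log_mul (by positivity) (by positivity), Real.log_exp, Real.log_pow]
  ring

/-- Stirling's formula is applied to (y+1)! so that it is valid at y = 0. The terms in log(y+1)
without the factor y cancel against those of `refWeight`, which is the reason for its form. -/
lemma log_weight_sub_log_refWeight {x : ℝ≥0} (hx : 0 < x) (y : ℕ) :
    Real.log (weight x y) - Real.log (refWeight y) =
      y * Real.log x - x + (y + 1) + (Real.log 2 - Real.log Real.pi) / 2
        - y * Real.log ((y : ℝ) + 1) - stirlingError y := by
  have h := Stirling.log_stirlingSeq_formula (y + 1)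
  have h1 : (0 : ℝ) < (y : ℝ) + 1 := by positivity
  rw [Nat.factorial_succ] at h
  push_cast at h
  rw [Real.log_mul h1.ne' (by positivity), Real.log_mul (by norm_num) h1.ne',
    Real.log_div h1.ne' (by positivity), Real.log_exp] at h
  rw [log_weight hx, log_refWeight, stirlingError, h, Real.log_sqrt Real.pi_pos.le]
  ring

lemma mul_log_succ_le (y : ℕ) : (y : ℝ) * Real.log ((y : ℝ) + 1) ≤ y * Real.log y + 1 := by
  rcases y.eq_zero_or_pos with rfl | hy
  · simp
  have hy' : (0 : ℝ) < y := by exact_mod_cast hy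
  have h := Real.log_le_sub_one_of_pos (x := ((y : ℝ) + 1) / y) (by positivity)
  rw [Real.log_div (by positivity) hy'.ne'] at h
  have h2 := mul_le_mul_of_nonneg_left h hy'.le
  have h3 : (y : ℝ) * (((y : ℝ) + 1) / y - 1) = 1 := by field_simp; ring
  linarith

lemma le_mul_log_succ (y : ℕ) :
    (y : ℝ) * Real.log y + 1 - ((y : ℝ) + 1)⁻¹ ≤ y * Real.log ((y : ℝ) + 1) := by
  rcases y.eq_zero_or_pos with rfl | hy
  · simp
  have hy' : (0 : ℝ) < y := by exact_mod_cast hy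
  have h := Real.one_sub_inv_le_log_of_pos (x := ((y : ℝ) + 1) / y) (by positivity)
  rw [Real.log_div (by positivity) hy'.ne'] at h
  have h2 := mul_le_mul_of_nonneg_left h hy'.le
  have h3 : (y : ℝ) * (1 - (((y : ℝ) + 1) / y)⁻¹) = 1 - ((y : ℝ) + 1)⁻¹ := by field_simp; ring
  linarith

lemma integrable_mul_log_succ_poisson (x : ℝ≥0) :
    Integrable (fun y : ℕ => (y : ℝ) * Real.log ((y : ℝ) + 1)) (poissonMeasure x) := by
  refine integrable_poisson_of_abs_le (C := 3) x fun y => ?_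
  rw [abs_of_nonneg (mul_nonneg y.cast_nonneg (Real.log_nonneg (by simp)))]
  have h1 := (abs_le.1 (abs_mul_log_cast_le y)).2
  have h2 := mul_log_succ_le y
  have h3 := Real.one_le_exp (y.cast_nonneg (α := ℝ))
  linarith

/-- The limit is 1/2 from the Taylor expansion of y log y plus 1 from replacing log y by log(y+1).
-/
lemma tendsto_integral_mul_log_succ :
    Filter.Tendsto (fun x : ℝ≥0 =>
      ∫ y : ℕ, (y : ℝ) * Real.log ((y : ℝ) + 1) ∂(poissonMeasure x) - x * Real.log x)
      Filter.atTop (nhds (3 / 2)) := by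
  have hl : Filter.Tendsto (fun x : ℝ≥0 => 3 / 2 - 2 * (x : ℝ)⁻¹) Filter.atTop
      (nhds (3 / 2)) := by
    simpa using (tendsto_inv_coe_nnreal.const_mul 2).const_sub (3 / 2)
  have hu : Filter.Tendsto (fun x : ℝ≥0 => 3 / 2 + 2 * (x : ℝ)⁻¹) Filter.atTop
      (nhds (3 / 2)) := by
    simpa using (tendsto_inv_coe_nnreal.const_mul 2).const_add (3 / 2)
  refine tendsto_of_tendsto_of_tendsto_of_le_of_le' hl hu ?_ ?_
  all_goals
    filter_upwards [Filter.eventually_ge_atTop 1] with x hx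
    have hx0 : 0 < x := lt_of_lt_of_le one_pos hx
    have hx' : (0 : ℝ) < x := hx0
  · have h1 := le_integral_mul_log_poisson hx0
    have h2 := integral_inv_succ_poisson_le hx0
    have h3 : ∫ y : ℕ, ((y : ℝ) * Real.log y + 1 - ((y : ℝ) + 1)⁻¹) ∂(poissonMeasure x) ≤
        ∫ y : ℕ, (y : ℝ) * Real.log ((y : ℝ) + 1) ∂(poissonMeasure x) :=
      integral_mono (((integrable_mul_log_poisson x).add (integrable_const _)).sub
        (integrable_inv_succ_poisson x)) (integrable_mul_log_succ_poisson x) le_mul_log_succ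
    rw [integral_sub ((integrable_mul_log_poisson x).fun_add (integrable_const _))
      (integrable_inv_succ_poisson x),
      integral_add (integrable_mul_log_poisson x) (integrable_const _)] at h3
    simp only [integral_const, probReal_univ, one_smul] at h3
    have h4 : 1 / (6 * (x : ℝ)) ≤ (x : ℝ)⁻¹ := by
      rw [← one_div]; exact one_div_le_one_div_of_le hx' (by linarith)
    linarith
  · have h1 := integral_mul_log_poisson_le hx
    have h3 : ∫ y : ℕ, (y : ℝ) * Real.log ((y : ℝ) + 1) ∂(poissonMeasure x) ≤
        ∫ y : ℕ, ((y : ℝ) * Real.log y + 1) ∂(poissonMeasure x) :=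
      integral_mono (integrable_mul_log_succ_poisson x)
        ((integrable_mul_log_poisson x).add (integrable_const _)) mul_log_succ_le
    rw [integral_add (integrable_mul_log_poisson x) (integrable_const _)] at h3
    simp only [integral_const, probReal_univ, one_smul] at h3
    rw [div_eq_mul_inv 2 (x : ℝ)] at h1
    linarith

lemma integrable_log_weight_sub {x : ℝ≥0} (hx : 0 < x) :
    Integrable (fun y : ℕ => Real.log (weight x y) - Real.log (refWeight y))
      (poissonMeasure x) := by
  simp_rw [log_weight_sub_log_refWeight hx]
  exact ((((((integrable_cast_poisson x).mul_const _).sub (integrable_const _)).add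
    ((integrable_cast_poisson x).add (integrable_const _))).add (integrable_const _)).sub
    (integrable_mul_log_succ_poisson x)).sub (integrable_stirlingError x)

lemma integral_log_weight_sub {x : ℝ≥0} (hx : 0 < x) :
    ∫ y, (Real.log (weight x y) - Real.log (refWeight y)) ∂(poissonMeasure x) =
      1 + (Real.log 2 - Real.log Real.pi) / 2
      - (∫ y : ℕ, (y : ℝ) * Real.log ((y : ℝ) + 1) ∂(poissonMeasure x) - x * Real.log x)
      - ∫ y, stirlingError y ∂(poissonMeasure x) := by
  simp_rw [log_weight_sub_log_refWeight hx]
  have i1 := (integrable_cast_poisson x).mul_const (Real.log x)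
  have i2 : Integrable (fun y : ℕ => (y : ℝ) * Real.log x - x) (poissonMeasure x) :=
    i1.sub (integrable_const (x : ℝ))
  have i3 := (integrable_cast_poisson x).fun_add (integrable_const (1 : ℝ))
  have i4 := (i2.fun_add i3).fun_add (integrable_const ((Real.log 2 - Real.log Real.pi) / 2))
  have i5 : Integrable (fun y : ℕ => (y : ℝ) * Real.log x - x + ((y : ℝ) + 1)
      + (Real.log 2 - Real.log Real.pi) / 2 - y * Real.log ((y : ℝ) + 1)) (poissonMeasure x) :=
    i4.sub (integrable_mul_log_succ_poisson x)
  rw [integral_sub i5 (integrable_stirlingError x),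
    integral_sub i4 (integrable_mul_log_succ_poisson x),
    integral_add (i2.fun_add i3) (integrable_const _), integral_add i2 i3,
    integral_sub i1 (integrable_const _), integral_add (integrable_cast_poisson x)
    (integrable_const _), integral_mul_const, integral_cast_poisson]
  simp only [integral_const, probReal_univ, one_smul]
  ring

/-- The constant `log √(2 / (π e))` in the capacity asymptotics `log √A + log √(2 / (π e))`. -/
noncomputable def capacityConst : ℝ := (Real.log 2 - Real.log Real.pi - 1) / 2

/-- All large inputs have asymptotically the same divergence from these weights. This equalizing
property is what makes the weights optimal, and it serves both the lower and the upper capacity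
bound. -/
lemma tendsto_integral_log_weight_sub :
    Filter.Tendsto (fun x : ℝ≥0 =>
      ∫ y, (Real.log (weight x y) - Real.log (refWeight y)) ∂(poissonMeasure x))
      Filter.atTop (nhds capacityConst) := by
  have h := (tendsto_integral_mul_log_succ.const_sub
    (1 + (Real.log 2 - Real.log Real.pi) / 2)).sub tendsto_integral_stirlingError
  have e : 1 + (Real.log 2 - Real.log Real.pi) / 2 - 3 / 2 - 0 = capacityConst := by
    unfold capacityConst; ring
  rw [e] at h
  refine h.congr' ?_
  filter_upwards [Filter.eventually_gt_atTop 0] with x hx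
  rw [integral_log_weight_sub hx]

end PoissonChannel

/-! ### Relative entropy -/

namespace InformationTheory

variable {α β : Type*} {mα : MeasurableSpace α} {mβ : MeasurableSpace β}

/-- The Donsker–Varadhan lower bound on the relative entropy. -/
lemma ofReal_integral_le_klDiv {μ ν : Measure α} [IsProbabilityMeasure μ]
    [IsProbabilityMeasure ν] {g : α → ℝ} (hgm : Measurable g) (hg : Integrable g μ)
    (hexp : ∫⁻ a, ENNReal.ofReal (Real.exp (g a)) ∂ν ≤ 1) :
    ENNReal.ofReal (∫ a, g a ∂μ) ≤ klDiv μ ν := by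
  by_cases htop : klDiv μ ν = ∞
  · simp [htop]
  obtain ⟨hac, hint⟩ := klDiv_ne_top_iff.1 htop
  have hexp_int : Integrable (fun a => Real.exp (g a)) ν := by
    refine ⟨hgm.exp.aestronglyMeasurable, ?_⟩
    rw [hasFiniteIntegral_iff_ofReal (Filter.Eventually.of_forall fun a => (Real.exp_pos _).le)]
    exact hexp.trans_lt ENNReal.one_lt_top
  have := isProbabilityMeasure_tilted hexp_int
  have hle : ∫ a, Real.exp (g a) ∂ν ≤ 1 := by
    rw [integral_eq_lintegral_of_nonneg_ae
      (Filter.Eventually.of_forall fun a => (Real.exp_pos _).le) hgm.exp.aestronglyMeasurable]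
    exact ENNReal.toReal_le_of_le_ofReal zero_le_one (by simpa using hexp)
  have hlog : Real.log (∫ a, Real.exp (g a) ∂ν) ≤ 0 :=
    Real.log_nonpos (integral_nonneg fun a => (Real.exp_pos _).le) hle
  -- Nonnegativity of the relative entropy of μ to ν tilted by g; the normalizing constant of the
  -- tilt is at most 1, so its logarithm can be dropped.
  have h0 := integral_llr_add_sub_measure_univ_nonneg
    (hac.trans (absolutelyContinuous_tilted hexp_int))
    (integrable_llr_tilted_right hac hg hint hexp_int)
  rw [integral_llr_tilted_right hac hg hexp_int hint] at h0
  rw [klDiv_of_ac_of_integrable hac hint]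
  refine ENNReal.ofReal_le_ofReal ?_
  simp only [probReal_univ] at h0 ⊢
  linarith

lemma klDiv_withDensity {ν : Measure α} [IsFiniteMeasure ν] {ρ : α → ℝ≥0∞} (hρ : Measurable ρ)
    [IsFiniteMeasure (ν.withDensity ρ)] :
    klDiv (ν.withDensity ρ) ν = ∫⁻ a, ENNReal.ofReal (klFun (ρ a).toReal) ∂ν := by
  rw [klDiv_eq_lintegral_klFun_of_ac (withDensity_absolutelyContinuous ν ρ)]
  refine lintegral_congr_ae ?_
  filter_upwards [Measure.rnDeriv_withDensity ν hρ] with a ha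
  rw [ha]

/-- Data processing along e and along its inverse. -/
lemma klDiv_map_measurableEquiv (μ ν : Measure α) [IsFiniteMeasure μ] [IsFiniteMeasure ν]
    (e : α ≃ᵐ β) : klDiv (μ.map e) (ν.map e) = klDiv μ ν := by
  refine le_antisymm (klDiv_map_le μ ν e.measurable) ?_
  have h := klDiv_map_le (μ.map e) (ν.map e) e.symm.measurable
  rwa [e.map_symm_map, e.map_symm_map] at h

end InformationTheory

/-! ### Divergences over a countable output and the compensation identity -/

namespace PoissonChannel

lemma measure_eq_withDensity_nat (μ Q : Measure ℕ) [IsFiniteMeasure Q] (hQ : ∀ y, Q {y} ≠ 0) :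
    μ = Q.withDensity fun y => μ {y} / Q {y} := by
  refine Measure.ext_of_singleton fun y => ?_
  rw [withDensity_apply _ (measurableSet_singleton y), lintegral_singleton,
    ENNReal.div_mul_cancel (hQ y) (measure_ne_top Q _)]

lemma klDiv_nat_eq (μ Q : Measure ℕ) [IsFiniteMeasure μ] [IsFiniteMeasure Q]
    (hQ : ∀ y, Q {y} ≠ 0) :
    klDiv μ Q = ∫⁻ y, ENNReal.ofReal (klFun (μ {y} / Q {y}).toReal) ∂Q := by
  have h := measure_eq_withDensity_nat μ Q hQ
  have : IsFiniteMeasure (Q.withDensity fun y => μ {y} / Q {y}) := h ▸ inferInstance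
  conv_lhs => rw [h]
  exact klDiv_withDensity Measurable.of_discrete

lemma channel_apply (x : ℝ≥0) : channel x = poissonMeasure x := rfl

lemma measurable_poisson_singleton (y : ℕ) : Measurable fun x => poissonMeasure x {y} :=
  channel.measurable_coe (measurableSet_singleton y)

lemma measurable_poisson_div (Q : Measure ℕ) :
    Measurable fun p : ℝ≥0 × ℕ => poissonMeasure p.1 {p.2} / Q {p.2} := by
  refine measurable_from_prod_countable_left fun y => ?_
  exact Measurable.div_const (measurable_poisson_singleton y) (Q {y})

lemma joint_eq_withDensity (P : Measure ℝ≥0) [IsProbabilityMeasure P] (Q : Measure ℕ)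
    [IsFiniteMeasure Q] (hQ : ∀ y, Q {y} ≠ 0) :
    joint P = (P.prod Q).withDensity fun p => poissonMeasure p.1 {p.2} / Q {p.2} := by
  refine Measure.ext_of_lintegral _ fun f hf => ?_
  rw [joint, Measure.lintegral_compProd hf,
    lintegral_withDensity_eq_lintegral_mul _ (measurable_poisson_div Q) hf,
    lintegral_prod _ ((measurable_poisson_div Q).mul hf).aemeasurable]
  refine lintegral_congr fun x => ?_
  rw [channel_apply]
  conv_lhs => rw [measure_eq_withDensity_nat (poissonMeasure x) Q hQ]
  rw [lintegral_withDensity_eq_lintegral_mul _ Measurable.of_discrete Measurable.of_discrete]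
  rfl

instance (P : Measure ℝ≥0) [IsProbabilityMeasure P] : IsProbabilityMeasure (joint P) := by
  unfold joint; infer_instance

instance (P : Measure ℝ≥0) [IsProbabilityMeasure P] : IsProbabilityMeasure (output P) :=
  Measure.isProbabilityMeasure_map measurable_snd.aemeasurable

lemma klDiv_joint_prod_eq (P : Measure ℝ≥0) [IsProbabilityMeasure P] (Q : Measure ℕ)
    [IsFiniteMeasure Q] (hQ : ∀ y, Q {y} ≠ 0) :
    klDiv (joint P) (P.prod Q) = ∫⁻ x, klDiv (poissonMeasure x) Q ∂P := by
  have h := joint_eq_withDensity P Q hQ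
  have hm := measurable_poisson_div Q
  simp_rw [klDiv_nat_eq _ Q hQ]
  generalize hρ : (fun p : ℝ≥0 × ℕ => poissonMeasure p.1 {p.2} / Q {p.2}) = ρ at h hm
  have : IsFiniteMeasure ((P.prod Q).withDensity ρ) := h ▸ inferInstance
  have hmeas : Measurable fun p => ENNReal.ofReal (klFun (ρ p).toReal) :=
    (measurable_klFun.comp hm.ennreal_toReal).ennreal_ofReal
  rw [h, klDiv_withDensity hm, lintegral_prod _ hmeas.aemeasurable]
  subst hρ
  rfl

/-- The compensation identity: replacing the output law by another law `Q` increases the mutual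
information by the relative entropy of the output law to `Q`. -/
lemma klDiv_joint_prod_eq_add (P : Measure ℝ≥0) [IsProbabilityMeasure P] (Q : Measure ℕ)
    [IsFiniteMeasure Q] :
    klDiv (joint P) (P.prod Q) = klDiv (output P) Q + mutualInformation P := by
  have hout : output P = channel ∘ₘ P := by
    rw [output, joint, ← Measure.snd, Measure.snd_compProd]
  -- Disintegrating over the output makes the joint law `output P` followed by the posterior, and
  -- the product law R followed by a constant kernel. In the chain rule the conditional term does
  -- not involve R, and it is the mutual information.
  have hswap : ∀ R : Measure ℕ, IsFiniteMeasure R → klDiv (joint P) (P.prod R) =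
      klDiv (output P ⊗ₘ channel†P) (R ⊗ₘ Kernel.const ℕ P) := by
    intro R hR
    rw [← klDiv_map_measurableEquiv _ _ (MeasurableEquiv.prodComm (α := ℝ≥0) (β := ℕ)),
      Measure.compProd_const, hout, compProd_posterior_eq_map_swap]
    congr 1
    exact Measure.prod_swap
  rw [hswap Q inferInstance, klDiv_compProd_eq_add, mutualInformation,
    hswap (output P) inferInstance]

end PoissonChannel

namespace PoissonChannel

/-! ### A lower bound on the capacity -/

lemma output_singleton (P : Measure ℝ≥0) [IsProbabilityMeasure P] (y : ℕ) :
    output P {y} = ∫⁻ x, ENNReal.ofReal (weight x y) ∂P := by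
  have hm : MeasurableSet (Prod.snd ⁻¹' {y} : Set (ℝ≥0 × ℕ)) :=
    measurable_snd (measurableSet_singleton y)
  rw [output, Measure.map_apply measurable_snd (measurableSet_singleton y), joint,
    Measure.compProd_apply hm]
  refine lintegral_congr fun x => ?_
  rw [← poissonMeasure_singleton_eq, channel_apply]
  rfl

lemma measurable_weight : Measurable fun p : ℝ≥0 × ℕ => weight p.1 p.2 := by
  refine measurable_from_prod_countable_left fun y => ?_
  unfold weight
  fun_prop

lemma abs_log_weight_le {x : ℝ≥0} (hx : 0 < x) (y : ℕ) :
    |Real.log (weight x y)| ≤ (|Real.log x| + x + 1) * (1 + (y : ℝ) ^ 2) := by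
  have hf : Real.log y.factorial ≤ (y : ℝ) ^ 2 := by
    calc Real.log y.factorial ≤ Real.log ((y : ℝ) ^ y) :=
          Real.log_le_log (by positivity) (by exact_mod_cast Nat.factorial_le_pow y)
      _ = y * Real.log y := Real.log_pow _ _
      _ ≤ y * y := mul_le_mul_of_nonneg_left (Real.log_le_self y.cast_nonneg) y.cast_nonneg
      _ = _ := (pow_two _).symm
  have hf0 : 0 ≤ Real.log y.factorial :=
    Real.log_nonneg (by exact_mod_cast Nat.one_le_iff_ne_zero.2 y.factorial_ne_zero)
  have hy : (y : ℝ) ≤ 1 + (y : ℝ) ^ 2 := by nlinarith [sq_nonneg ((y : ℝ) - 1)]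
  have h1 : |(y : ℝ) * Real.log x| ≤ (1 + (y : ℝ) ^ 2) * |Real.log x| := by
    rw [abs_mul, Nat.abs_cast]
    gcongr
  have hx' : (0 : ℝ) ≤ x := x.coe_nonneg
  have h2 : (x : ℝ) ≤ x * (1 + (y : ℝ) ^ 2) := le_mul_of_one_le_right hx' (by nlinarith)
  rw [log_weight hx, abs_le] at *
  constructor <;> nlinarith [h1.1, h1.2]

lemma abs_log_refWeight_le (y : ℕ) : |Real.log (refWeight y)| ≤ 2 * (1 + (y : ℝ) ^ 2) := by
  rw [log_refWeight, abs_neg, abs_of_nonneg]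
  · have h1 : Real.log 2 ≤ 1 := by linarith [Real.log_two_lt_d9]
    have h2 := Real.log_le_sub_one_of_pos (x := (y : ℝ) + 1) (by positivity)
    nlinarith [sq_nonneg ((y : ℝ) - 1)]
  · have := Real.log_nonneg one_le_two
    have := Real.log_nonneg (show (1 : ℝ) ≤ (y : ℝ) + 1 by simp)
    positivity

lemma integrable_joint_of_abs_le {P : Measure ℝ≥0} [IsProbabilityMeasure P] {A : ℝ≥0}
    (hA : ∀ᵐ x ∂P, x ≤ A) {g : ℝ≥0 × ℕ → ℝ} (hg : Measurable g) {B : ℝ}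
    (hB : ∀ᵐ x ∂P, ∀ y, |g (x, y)| ≤ B * (1 + (y : ℝ) ^ 2)) : Integrable g (joint P) := by
  have hi : ∀ x, Integrable (fun y : ℕ => B * (1 + (y : ℝ) ^ 2)) (poissonMeasure x) :=
    fun x => ((integrable_const _).add (integrable_pow_poisson x 2)).const_mul B
  refine (Measure.integrable_compProd_iff hg.aestronglyMeasurable).2 ⟨?_, ?_⟩
  · filter_upwards [hB] with x hx
    exact (hi x).mono' Measurable.of_discrete.aestronglyMeasurable
      (Filter.Eventually.of_forall hx)
  · refine (integrable_const (B * (1 + (A ^ 2 + A)))).mono'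
      (hg.norm.stronglyMeasurable.integral_kernel_prod_right' (κ := channel)).aestronglyMeasurable
      ?_
    filter_upwards [hA, hB] with x hxA hx
    rw [Real.norm_of_nonneg (integral_nonneg fun _ => norm_nonneg _)]
    have hB0 : 0 ≤ B := by
      have := (abs_nonneg _).trans (hx 0)
      simpa using this
    have hxA' : (x : ℝ) ≤ A := hxA
    calc _ ≤ ∫ y : ℕ, B * (1 + (y : ℝ) ^ 2) ∂(poissonMeasure x) :=
          integral_mono_of_nonneg (Filter.Eventually.of_forall fun _ => norm_nonneg _) (hi x)
            (Filter.Eventually.of_forall hx)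
      _ = B * (1 + (x ^ 2 + x)) := by
          rw [integral_const_mul, integral_add (integrable_const _) (integrable_pow_poisson x 2),
            integral_pow_two_poisson]
          simp
      _ ≤ _ := by gcongr

/-- A lower bound on the mutual information from an upper bound `G` on the output law. -/
lemma le_mutualInformation {P : Measure ℝ≥0} [IsProbabilityMeasure P] {a A : ℝ≥0} (ha : 0 < a)
    (hP : ∀ᵐ x ∂P, a ≤ x ∧ x ≤ A) {G : ℕ → ℝ} (hG : ∀ y, 0 < G y)
    (hout : ∀ y, output P {y} ≤ ENNReal.ofReal (G y)) {B : ℝ}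
    (hB : ∀ y, |Real.log (G y)| ≤ B * (1 + (y : ℝ) ^ 2)) {c : ℝ}
    (hc : ∀ x, a ≤ x → x ≤ A →
      c ≤ ∫ y, (Real.log (weight x y) - Real.log (G y)) ∂(poissonMeasure x)) :
    ENNReal.ofReal c ≤ mutualInformation P := by
  set g : ℝ≥0 × ℕ → ℝ := fun p => Real.log (weight p.1 p.2) - Real.log (G p.2)
  have hgm : Measurable g := by
    refine measurable_weight.log.sub ?_
    exact (Measurable.of_discrete (f := fun y => Real.log (G y))).comp measurable_snd
  obtain ⟨M, hM⟩ : ∃ M, ∀ x : ℝ≥0, a ≤ x → x ≤ A → |Real.log x| ≤ M := by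
    refine ⟨max |Real.log a| |Real.log A|, fun x h1 h2 => ?_⟩
    have ha' : (0 : ℝ) < a := ha
    have h1' : (a : ℝ) ≤ x := h1
    have h2' : (x : ℝ) ≤ A := h2
    exact abs_le_max_abs_abs (Real.log_le_log ha' h1')
      (Real.log_le_log (ha'.trans_le h1') h2')
  have hg : Integrable g (joint P) := by
    refine integrable_joint_of_abs_le (A := A) (hP.mono fun x hx => hx.2) hgm
      (B := M + A + 1 + B) ?_
    filter_upwards [hP] with x hx y
    have h1 := abs_log_weight_le (ha.trans_le hx.1) y
    have h2 := hM x hx.1 hx.2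
    have h3 : (x : ℝ) ≤ A := hx.2
    calc |g (x, y)| ≤ |Real.log (weight x y)| + |Real.log (G y)| := abs_sub _ _
      _ ≤ (M + A + 1) * (1 + (y : ℝ) ^ 2) + B * (1 + (y : ℝ) ^ 2) := by
          refine add_le_add (h1.trans ?_) (hB y)
          gcongr
      _ = _ := by ring
  -- Here exp g = W/G, and the output law is at most G, so for each x the sum is at most ∑ y, W(y|x)
  -- = 1.
  have hexp : ∫⁻ p, ENNReal.ofReal (Real.exp (g p)) ∂(P.prod (output P)) ≤ 1 := by
    rw [lintegral_prod _ hgm.exp.ennreal_ofReal.aemeasurable]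
    calc _ ≤ ∫⁻ _, 1 ∂P := by
          refine lintegral_mono_ae ?_
          filter_upwards [hP] with x hx
          have hx0 := ha.trans_le hx.1
          rw [lintegral_countable', ← measure_univ (μ := poissonMeasure x),
            ← lintegral_one, lintegral_countable']
          refine ENNReal.tsum_le_tsum fun y => ?_
          rw [one_mul, poissonMeasure_singleton_eq]
          simp only [g]
          rw [Real.exp_sub, Real.exp_log (weight_pos hx0 y), Real.exp_log (hG y)]
          calc _ ≤ ENNReal.ofReal (weight x y / G y) * ENNReal.ofReal (G y) := by
                gcongr; exact hout y
            _ = _ := by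
                rw [← ENNReal.ofReal_mul (div_nonneg (weight_nonneg x y) (hG y).le),
                  div_mul_cancel₀ _ (hG y).ne']
      _ = 1 := by simp
  refine le_trans (ENNReal.ofReal_le_ofReal ?_) (ofReal_integral_le_klDiv hgm hg hexp)
  rw [joint, Measure.integral_compProd hg]
  calc c = ∫ _, c ∂P := by simp
    _ ≤ _ := by
        refine integral_mono_ae (integrable_const _) hg.integral_compProd ?_
        filter_upwards [hP] with x hx
        exact hc x hx.1 hx.2

end PoissonChannel

/-! ### The output law of an input with nearly uniform square root -/

namespace PoissonChannel

/-- Log-convexity of Γ between y and y+1 gives the bound y!/√y. The exponential factor pays for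
passing from √y to √(y+1), and also covers y = 0, where Γ(1/2) = √π ≤ e. -/
lemma Gamma_add_half_le (y : ℕ) :
    Real.Gamma ((y : ℝ) + 1 / 2) ≤
      y.factorial * (Real.exp (((y : ℝ) + 1)⁻¹) / √((y : ℝ) + 1)) := by
  rcases y.eq_zero_or_pos with rfl | hy
  · have h1 : √Real.pi ≤ 2 := Real.sqrt_le_iff.2 ⟨by norm_num, by linarith [Real.pi_lt_four]⟩
    have h2 : (2 : ℝ) ≤ Real.exp 1 := by linarith [Real.exp_one_gt_d9]
    rw [Nat.cast_zero, zero_add, Real.Gamma_one_half_eq]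
    simpa using h1.trans h2
  have hy' : (0 : ℝ) < y := by exact_mod_cast hy
  have h := Real.Gamma_mul_add_mul_le_rpow_Gamma_mul_rpow_Gamma (s := y) (t := y + 1)
    (a := 1 / 2) (b := 1 / 2) hy' (by positivity) (by norm_num) (by norm_num) (by norm_num)
  rw [← Real.sqrt_eq_rpow, ← Real.sqrt_eq_rpow, Real.Gamma_nat_eq_factorial] at h
  have hG : Real.Gamma y = y.factorial / y := by
    rw [← Real.Gamma_nat_eq_factorial, Real.Gamma_add_one hy'.ne']
    field_simp
  have hle : 1 / √(y : ℝ) ≤ Real.exp (((y : ℝ) + 1)⁻¹) / √((y : ℝ) + 1) := by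
    rw [div_le_div_iff₀ (by positivity) (by positivity), one_mul]
    refine Real.sqrt_le_iff.2 ⟨by positivity, ?_⟩
    rw [mul_pow, Real.sq_sqrt hy'.le, ← Real.exp_nat_mul]
    have h2 := Real.add_one_le_exp (((2 : ℕ) : ℝ) * ((y : ℝ) + 1)⁻¹)
    have h3 : (y : ℝ) + 1 ≤ (((2 : ℕ) : ℝ) * ((y : ℝ) + 1)⁻¹ + 1) * y := by
      have h1y : (1 : ℝ) ≤ y := by exact_mod_cast hy
      push_cast
      rw [← sub_nonneg]
      have : (2 * ((y : ℝ) + 1)⁻¹ + 1) * y - (y + 1) = (y - 1) / (y + 1) := by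
        field_simp; ring
      rw [this]
      exact div_nonneg (by linarith) (by positivity)
    exact h3.trans (mul_le_mul_of_nonneg_right h2 hy'.le)
  calc Real.Gamma ((y : ℝ) + 1 / 2) = Real.Gamma (1 / 2 * y + 1 / 2 * (y + 1)) := by ring_nf
    _ ≤ √(Real.Gamma y) * √(y.factorial) := h
    _ = y.factorial * (1 / √(y : ℝ)) := by
        rw [hG, Real.sqrt_div (by positivity)]
        have := Real.mul_self_sqrt (Nat.cast_nonneg (α := ℝ) y.factorial)
        field_simp
        nlinarith
    _ ≤ _ := by gcongr

/-- The law of `A s²` when `s` is uniform on `[δ, 1]`. -/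
noncomputable def uniformSqrtInput (δ : ℝ) (A : ℝ≥0) : Measure ℝ≥0 :=
  (ENNReal.ofReal (1 - δ)⁻¹ • volume.restrict (Set.Icc δ 1)).map
    fun s : ℝ => ((A : ℝ) * s ^ 2).toNNReal

lemma measurable_mul_sq_toNNReal (A : ℝ≥0) :
    Measurable fun s : ℝ => ((A : ℝ) * s ^ 2).toNNReal := by fun_prop

lemma isProbabilityMeasure_uniformSqrtInput {δ : ℝ} (hδ : δ < 1) (A : ℝ≥0) :
    IsProbabilityMeasure (uniformSqrtInput δ A) := by
  have : IsProbabilityMeasure (ENNReal.ofReal (1 - δ)⁻¹ • volume.restrict (Set.Icc δ 1)) := by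
    refine ⟨?_⟩
    have h : 0 < 1 - δ := by linarith
    rw [Measure.smul_apply, Measure.restrict_apply_univ, Real.volume_Icc, smul_eq_mul,
      ← ENNReal.ofReal_mul (by positivity), inv_mul_cancel₀ h.ne', ENNReal.ofReal_one]
  exact Measure.isProbabilityMeasure_map (measurable_mul_sq_toNNReal A).aemeasurable

lemma ae_uniformSqrtInput {δ : ℝ} (hδ : 0 ≤ δ) (A : ℝ≥0) :
    ∀ᵐ x ∂(uniformSqrtInput δ A), ((A : ℝ) * δ ^ 2).toNNReal ≤ x ∧ x ≤ A := by
  refine (ae_map_iff (measurable_mul_sq_toNNReal A).aemeasurable measurableSet_Icc).2 ?_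
  refine Measure.ae_smul_measure ?_ _
  filter_upwards [ae_restrict_mem measurableSet_Icc] with s hs
  have h0 : 0 ≤ s := hδ.trans hs.1
  have h1 := hs.1
  have h2 : s ^ 2 ≤ 1 := by nlinarith [hs.2]
  refine ⟨Real.toNNReal_le_toNNReal (by gcongr), ?_⟩
  rw [Real.toNNReal_le_iff_le_coe]
  exact mul_le_of_le_one_right A.coe_nonneg h2

lemma lintegral_weight_mul_sq {A : ℝ≥0} (hA : 0 < A) (y : ℕ) :
    ∫⁻ s in Set.Ioi (0 : ℝ), ENNReal.ofReal (weight ((A : ℝ) * s ^ 2).toNNReal y) =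
      ENNReal.ofReal (Real.Gamma ((y : ℝ) + 1 / 2) / (2 * y.factorial * √A)) := by
  have hA' : (0 : ℝ) < A := hA
  have hI := integral_rpow_mul_exp_neg_mul_rpow (p := 2) (q := 2 * y) (b := A) two_pos
    (by linarith [y.cast_nonneg (α := ℝ)]) hA'
  have hint := integrableOn_rpow_mul_exp_neg_mul_rpow (p := 2) (s := 2 * y) (b := A)
    (by linarith [y.cast_nonneg (α := ℝ)]) two_pos hA'
  calc _ = ∫⁻ s in Set.Ioi (0 : ℝ), ENNReal.ofReal ((A : ℝ) ^ y / y.factorial *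
        (s ^ (2 * y : ℝ) * Real.exp (-A * s ^ (2 : ℝ)))) := by
        refine setLIntegral_congr_fun measurableSet_Ioi fun s hs => ?_
        have hs' : 0 ≤ s := (Set.mem_Ioi.1 hs).le
        have e1 : s ^ (2 * y : ℝ) = (s ^ 2) ^ y := by
          rw [Real.rpow_mul hs', Real.rpow_natCast, Real.rpow_two]
        rw [weight, Real.coe_toNNReal _ (by positivity), e1, Real.rpow_two, mul_pow, neg_mul]
        congr 1
        ring
    _ = ENNReal.ofReal (∫ s in Set.Ioi (0 : ℝ), (A : ℝ) ^ y / y.factorial *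
        (s ^ (2 * y : ℝ) * Real.exp (-A * s ^ (2 : ℝ)))) := by
        rw [ofReal_integral_eq_lintegral_ofReal (hint.const_mul _)]
        filter_upwards [ae_restrict_mem measurableSet_Ioi] with s hs
        have hs' : 0 ≤ s := (Set.mem_Ioi.1 hs).le
        positivity
    _ = _ := by
        rw [integral_const_mul, hI]
        congr 1
        have e2 : -(2 * (y : ℝ) + 1) / 2 = -(y + 1 / 2) := by ring
        have e3 : (2 * (y : ℝ) + 1) / 2 = y + 1 / 2 := by ring
        rw [e2, e3, Real.rpow_neg hA'.le, Real.rpow_add hA', Real.rpow_natCast,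
          ← Real.sqrt_eq_rpow]
        field_simp

/-- An upper bound on the output law of `uniformSqrtInput δ A`. -/
noncomputable def uniformSqrtBound (δ : ℝ) (A : ℝ≥0) (y : ℕ) : ℝ :=
  refWeight y * Real.exp (((y : ℝ) + 1)⁻¹) * ((1 - δ)⁻¹ / √A)

/-- Only an upper bound is needed, so the average over s in [δ, 1] is enlarged to (0, ∞), where it
is an explicit Gamma integral. -/
lemma output_uniformSqrtInput_le {δ : ℝ} (hδ0 : 0 < δ) (hδ : δ < 1) {A : ℝ≥0} (hA : 0 < A)
    (y : ℕ) : output (uniformSqrtInput δ A) {y} ≤ ENNReal.ofReal (uniformSqrtBound δ A y) := by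
  have := isProbabilityMeasure_uniformSqrtInput hδ A
  have hδ1 : 0 < 1 - δ := by linarith
  have hm : Measurable fun x => ENNReal.ofReal (weight x y) := by
    unfold weight; fun_prop
  rw [output_singleton, uniformSqrtInput, lintegral_map hm (measurable_mul_sq_toNNReal A),
    lintegral_smul_measure, smul_eq_mul]
  calc _ ≤ ENNReal.ofReal (1 - δ)⁻¹ *
        ∫⁻ s in Set.Ioi (0 : ℝ), ENNReal.ofReal (weight ((A : ℝ) * s ^ 2).toNNReal y) := by
        gcongr
        exact fun s hs => hδ0.trans_le hs.1
    _ ≤ _ := by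
        have hA' : (0 : ℝ) < A := hA
        rw [lintegral_weight_mul_sq hA, ← ENNReal.ofReal_mul (by positivity)]
        refine ENNReal.ofReal_le_ofReal ?_
        have h := Gamma_add_half_le y
        rw [uniformSqrtBound, refWeight]
        calc _ ≤ (1 - δ)⁻¹ * (y.factorial * (Real.exp (((y : ℝ) + 1)⁻¹) / √((y : ℝ) + 1))
              / (2 * y.factorial * √A)) := by gcongr
          _ = _ := by field_simp

lemma log_uniformSqrtBound {δ : ℝ} (hδ : δ < 1) {A : ℝ≥0} (hA : 0 < A) (y : ℕ) :
    Real.log (uniformSqrtBound δ A y) =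
      Real.log (refWeight y) + ((y : ℝ) + 1)⁻¹ - (Real.log (1 - δ) + Real.log A / 2) := by
  have hδ1 : 0 < 1 - δ := by linarith
  have hA' : (0 : ℝ) < A := hA
  have := refWeight_pos y
  rw [uniformSqrtBound, Real.log_mul (by positivity) (by positivity),
    Real.log_mul (by positivity) (by positivity), Real.log_exp,
    Real.log_div (by positivity) (by positivity), Real.log_inv, Real.log_sqrt hA'.le]
  ring

/-- Cutting off s < δ keeps the input above δ²A, so the limit of the divergence integral applies
uniformly on its support. The loss η is split equally between that limit, the cut-off term log(1-δ),
and the mean of 1/(y+1). -/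
lemma eventually_le_capacity {η : ℝ} (hη : 0 < η) :
    ∀ᶠ A : ℝ≥0 in Filter.atTop,
      ENNReal.ofReal (Real.log A / 2 + capacityConst - η) ≤ capacity A := by
  obtain ⟨δ, hδ0, hδ1, hδ⟩ : ∃ δ : ℝ, 0 < δ ∧ δ < 1 ∧ -(η / 3) < Real.log (1 - δ) := by
    refine ⟨1 - Real.exp (-(η / 6)), ?_, ?_, ?_⟩
    · have : Real.exp (-(η / 6)) < 1 := by
        rw [← Real.exp_zero]; exact Real.exp_lt_exp.2 (by linarith)
      linarith
    · linarith [Real.exp_pos (-(η / 6))]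
    · rw [sub_sub_cancel, Real.log_exp]; linarith
  have h1 := tendsto_integral_log_weight_sub.eventually
    (lt_mem_nhds (show capacityConst - η / 3 < capacityConst by linarith))
  have h2 := tendsto_inv_coe_nnreal.eventually (gt_mem_nhds (show 0 < η / 3 by linarith))
  obtain ⟨K, hK⟩ := Filter.eventually_atTop.1 (h1.and h2)
  have hlim : Filter.Tendsto (fun A : ℝ≥0 => ((A : ℝ) * δ ^ 2).toNNReal) Filter.atTop
      Filter.atTop := by
    refine tendsto_real_toNNReal_atTop.comp ?_
    exact (NNReal.tendsto_coe_atTop.2 Filter.tendsto_id).atTop_mul_const (by positivity)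
  filter_upwards [Filter.eventually_gt_atTop 0, hlim.eventually_ge_atTop K] with A hA hAK
  have hA' : (0 : ℝ) < A := hA
  have ha : 0 < ((A : ℝ) * δ ^ 2).toNNReal := Real.toNNReal_pos.2 (by positivity)
  have := isProbabilityMeasure_uniformSqrtInput hδ1 A
  have hae := ae_uniformSqrtInput hδ0.le A
  have hδ' : 0 < 1 - δ := by linarith
  have hadm : IsAdmissible A (uniformSqrtInput δ A) := ⟨this, hae.mono fun x hx => hx.2⟩
  refine le_trans ?_ (le_iSup₂ (f := fun P (_ : IsAdmissible A P) => mutualInformation P) _ hadm)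
  refine le_mutualInformation ha hae (G := uniformSqrtBound δ A)
    (B := 3 + |Real.log (1 - δ) + Real.log A / 2|)
    (fun y => ?_) (output_uniformSqrtInput_le hδ0 hδ1 hA) (fun y => ?_) (fun x hx hxA => ?_)
  · have := refWeight_pos y
    unfold uniformSqrtBound; positivity
  · rw [log_uniformSqrtBound hδ1 hA]
    have h1 := abs_log_refWeight_le y
    have h2 : |((y : ℝ) + 1)⁻¹| ≤ 1 := by
      rw [abs_of_nonneg (by positivity)]
      exact inv_le_one_of_one_le₀ (by simp)
    have h3 := abs_sub (Real.log (refWeight y) + ((y : ℝ) + 1)⁻¹)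
      (Real.log (1 - δ) + Real.log A / 2)
    have h4 := abs_add_le (Real.log (refWeight y)) ((y : ℝ) + 1)⁻¹
    nlinarith [abs_nonneg (Real.log (1 - δ) + Real.log A / 2), sq_nonneg (y : ℝ)]
  · obtain ⟨hK1, hK2⟩ := hK x (hAK.trans hx)
    have hx0 := ha.trans_le hx
    have h3 := integral_inv_succ_poisson_le hx0
    simp_rw [log_uniformSqrtBound hδ1 hA]
    have e : ∀ y : ℕ, Real.log (weight x y) - (Real.log (refWeight y) + ((y : ℝ) + 1)⁻¹ -
        (Real.log (1 - δ) + Real.log A / 2)) =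
        (Real.log (weight x y) - Real.log (refWeight y)) +
          ((Real.log (1 - δ) + Real.log A / 2) - ((y : ℝ) + 1)⁻¹) := fun y => by ring
    simp_rw [e]
    have hi : Integrable (fun y : ℕ => Real.log (1 - δ) + Real.log A / 2 - ((y : ℝ) + 1)⁻¹)
        (poissonMeasure x) := (integrable_const _).sub (integrable_inv_succ_poisson x)
    rw [integral_add (integrable_log_weight_sub hx0) hi,
      integral_sub (integrable_const _) (integrable_inv_succ_poisson x)]
    simp only [integral_const, probReal_univ, one_smul]
    linarith

end PoissonChannel

namespace PoissonChannel

/-! ### A reference output law with small relative entropy from every input -/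

/-- With its companion below, a telescoping comparison that pins the partial sums of the weights to
√n up to O(1). -/
lemma refWeight_le_sqrt_sub (y : ℕ) : refWeight y ≤ √((y : ℝ) + 1) - √y := by
  have h1 : 0 < √((y : ℝ) + 1) := by positivity
  have h2 := Real.sq_sqrt (show 0 ≤ (y : ℝ) + 1 by positivity)
  have h3 := Real.sq_sqrt (y.cast_nonneg (α := ℝ))
  rw [refWeight, div_le_iff₀ (by positivity)]
  nlinarith [sq_nonneg (√((y : ℝ) + 1) - √y)]

lemma sqrt_sub_le_refWeight (y : ℕ) : √((y : ℝ) + 2) - √((y : ℝ) + 1) ≤ refWeight y := by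
  have h1 : 0 < √((y : ℝ) + 1) := by positivity
  have h2 := Real.sq_sqrt (show 0 ≤ (y : ℝ) + 1 by positivity)
  have h3 := Real.sq_sqrt (show 0 ≤ (y : ℝ) + 2 by positivity)
  rw [refWeight, le_div_iff₀ (by positivity)]
  nlinarith [sq_nonneg (√((y : ℝ) + 2) - √((y : ℝ) + 1))]

lemma sum_refWeight_le (n : ℕ) : ∑ y ∈ Finset.range n, refWeight y ≤ √n := by
  induction n with
  | zero => simp
  | succ n ih =>
    rw [Finset.sum_range_succ]
    push_cast
    linarith [refWeight_le_sqrt_sub n]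

lemma le_sum_refWeight (n : ℕ) : √((n : ℝ) + 1) - 1 ≤ ∑ y ∈ Finset.range n, refWeight y := by
  induction n with
  | zero => simp
  | succ n ih =>
    rw [Finset.sum_range_succ]
    push_cast
    have := sqrt_sub_le_refWeight n
    rw [add_assoc, one_add_one_eq_two]
    linarith

lemma refWeight_le_one (y : ℕ) : refWeight y ≤ 1 := by
  have h1 : 1 ≤ √((y : ℝ) + 1) := Real.one_le_sqrt.2 (by simp)
  rw [refWeight, div_le_one (by positivity)]
  linarith

/-- A mixture of the weights `refWeight` on `{0, …, N - 1}` and a heavy-tailed law. -/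
noncomputable def refOutput (ε : ℝ) (N y : ℕ) : ℝ :=
  (1 - ε) * (if y < N then refWeight y / √N else 0) + ε / ((y + 1) * (y + 2))

lemma refOutput_pos {ε : ℝ} (h0 : 0 < ε) (h1 : ε < 1) (N y : ℕ) : 0 < refOutput ε N y := by
  have := refWeight_pos y
  have : 0 < 1 - ε := by linarith
  unfold refOutput
  split_ifs <;> positivity

lemma sum_inv_mul (n : ℕ) :
    ∑ y ∈ Finset.range n, 1 / (((y : ℝ) + 1) * (y + 2)) = 1 - 1 / (n + 1) := by
  induction n with
  | zero => simp
  | succ n ih =>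
    rw [Finset.sum_range_succ, ih]
    push_cast
    field_simp
    ring

lemma sum_refOutput_le {ε : ℝ} (h0 : 0 < ε) (h1 : ε < 1) (N n : ℕ) :
    ∑ y ∈ Finset.range n, refOutput ε N y ≤ 1 := by
  have e : ∀ y, refOutput ε N y = (1 - ε) * (if y < N then refWeight y / √N else 0)
      + ε * (1 / (((y : ℝ) + 1) * (y + 2))) := fun y => by unfold refOutput; ring
  simp_rw [e]
  rw [Finset.sum_add_distrib, ← Finset.mul_sum, ← Finset.mul_sum, sum_inv_mul,
    ← Finset.sum_filter, ← Finset.sum_div]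
  have h2 : ∑ y ∈ (Finset.range n).filter (· < N), refWeight y ≤ √N := by
    refine le_trans (Finset.sum_le_sum_of_subset_of_nonneg ?_ fun y _ _ =>
      (refWeight_pos y).le) (sum_refWeight_le N)
    intro y hy
    exact Finset.mem_range.2 (Finset.mem_filter.1 hy).2
  have h3 : (∑ y ∈ (Finset.range n).filter (· < N), refWeight y) / √N ≤ 1 :=
    div_le_one_of_le₀ h2 (Real.sqrt_nonneg _)
  have h4 : (0 : ℝ) ≤ 1 / (n + 1) := by positivity
  nlinarith

/-- The measure on `ℕ` with the masses `refOutput ε N`. -/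
noncomputable def refOutputMeasure (ε : ℝ) (N : ℕ) : Measure ℕ :=
  Measure.count.withDensity fun y => ENNReal.ofReal (refOutput ε N y)

lemma refOutputMeasure_singleton (ε : ℝ) (N y : ℕ) :
    refOutputMeasure ε N {y} = ENNReal.ofReal (refOutput ε N y) := by
  rw [refOutputMeasure, withDensity_apply _ (measurableSet_singleton y), lintegral_singleton,
    Measure.count_singleton, mul_one]

lemma refOutputMeasure_singleton_ne_zero {ε : ℝ} (h0 : 0 < ε) (h1 : ε < 1) (N y : ℕ) :
    refOutputMeasure ε N {y} ≠ 0 := by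
  rw [refOutputMeasure_singleton]
  exact (ENNReal.ofReal_pos.2 (refOutput_pos h0 h1 N y)).ne'

lemma tsum_ofReal_refOutput_le {ε : ℝ} (h0 : 0 < ε) (h1 : ε < 1) (N : ℕ) :
    ∑' y, ENNReal.ofReal (refOutput ε N y) ≤ 1 := by
  refine ENNReal.tsum_le_of_sum_range_le fun n => ?_
  rw [← ENNReal.ofReal_sum_of_nonneg fun y _ => (refOutput_pos h0 h1 N y).le]
  exact ENNReal.ofReal_le_one.2 (sum_refOutput_le h0 h1 N n)

lemma refOutputMeasure_univ_le {ε : ℝ} (h0 : 0 < ε) (h1 : ε < 1) (N : ℕ) :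
    refOutputMeasure ε N Set.univ ≤ 1 := by
  rw [refOutputMeasure, withDensity_apply _ MeasurableSet.univ, Measure.restrict_univ,
    lintegral_count]
  exact tsum_ofReal_refOutput_le h0 h1 N

lemma isFiniteMeasure_refOutputMeasure {ε : ℝ} (h0 : 0 < ε) (h1 : ε < 1) (N : ℕ) :
    IsFiniteMeasure (refOutputMeasure ε N) :=
  ⟨(refOutputMeasure_univ_le h0 h1 N).trans_lt ENNReal.one_lt_top⟩

lemma refOutput_le_one {ε : ℝ} (h0 : 0 < ε) (h1 : ε < 1) (N y : ℕ) : refOutput ε N y ≤ 1 :=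
  le_trans (Finset.single_le_sum (f := refOutput ε N)
    (fun y _ => (refOutput_pos h0 h1 N y).le) (Finset.self_mem_range_succ y))
    (sum_refOutput_le h0 h1 N (y + 1))

lemma neg_log_refOutput_le {ε : ℝ} (h0 : 0 < ε) (h1 : ε < 1) (N y : ℕ) :
    -Real.log (refOutput ε N y) ≤ -Real.log ε + 2 * Real.log ((y : ℝ) + 2) := by
  have h2 : ε / ((y + 1) * (y + 2)) ≤ refOutput ε N y := by
    have := refWeight_pos y
    have : 0 < 1 - ε := by linarith
    unfold refOutput
    split_ifs
    · have : 0 ≤ (1 - ε) * (refWeight y / √N) := by positivity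
      linarith
    · simp
  have h3 := Real.log_le_log (by positivity) h2
  rw [Real.log_div h0.ne' (by positivity), Real.log_mul (by positivity) (by positivity)] at h3
  have h4 : Real.log ((y : ℝ) + 1) ≤ Real.log ((y : ℝ) + 2) :=
    Real.log_le_log (by positivity) (by linarith)
  linarith

lemma abs_log_refOutput_le {ε : ℝ} (h0 : 0 < ε) (h1 : ε < 1) (N y : ℕ) :
    |Real.log (refOutput ε N y)| ≤ (-Real.log ε + 4) * (1 + (y : ℝ) ^ 2) := by
  have h2 := neg_log_refOutput_le h0 h1 N y
  have h3 := Real.log_nonpos (refOutput_pos h0 h1 N y).le (refOutput_le_one h0 h1 N y)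
  have h4 := Real.log_le_sub_one_of_pos (x := (y : ℝ) + 2) (by positivity)
  have h5 := Real.log_nonpos h0.le h1.le
  rw [abs_of_nonpos h3]
  nlinarith [sq_nonneg ((y : ℝ) - 1), sq_nonneg (y : ℝ)]

lemma exists_abs_log_weight_le (x : ℝ≥0) :
    ∃ C, ∀ y : ℕ, |Real.log (weight x y)| ≤ C * (1 + (y : ℝ) ^ 2) := by
  rcases eq_zero_or_pos x with rfl | hx
  · refine ⟨0, fun y => ?_⟩
    rcases y with _ | y <;> simp [weight]
  · exact ⟨_, abs_log_weight_le hx⟩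

lemma integrable_log_div_refOutput {ε : ℝ} (h0 : 0 < ε) (h1 : ε < 1) (N : ℕ) (x : ℝ≥0) :
    Integrable (fun y => Real.log (weight x y / refOutput ε N y)) (poissonMeasure x) := by
  obtain ⟨C, hC⟩ := exists_abs_log_weight_le x
  have hi : Integrable (fun y : ℕ => (C + (-Real.log ε + 4)) * (1 + (y : ℝ) ^ 2))
      (poissonMeasure x) :=
    ((integrable_const _).add (integrable_pow_poisson x 2)).const_mul _
  refine hi.mono' Measurable.of_discrete.aestronglyMeasurable
    (Filter.Eventually.of_forall fun y => ?_)
  have h2 := hC y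
  have h3 := abs_log_refOutput_le h0 h1 N y
  rw [Real.norm_eq_abs, add_mul]
  rcases (weight_nonneg x y).eq_or_lt with hw | hw
  · rw [← hw, zero_div, Real.log_zero, abs_zero]
    exact add_nonneg ((abs_nonneg _).trans h2) ((abs_nonneg _).trans h3)
  · rw [Real.log_div hw.ne' (refOutput_pos h0 h1 N y).ne']
    exact (abs_sub _ _).trans (add_le_add h2 h3)

/-- The reference measure has mass at most 1, possibly less; the mass correction in `klDiv` is then
nonpositive and can be dropped. -/
lemma klDiv_poisson_refOutput_le {ε : ℝ} (h0 : 0 < ε) (h1 : ε < 1) (N : ℕ) (x : ℝ≥0) :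
    klDiv (poissonMeasure x) (refOutputMeasure ε N) ≤
      ENNReal.ofReal (∫ y, Real.log (weight x y / refOutput ε N y) ∂(poissonMeasure x)) := by
  have := isFiniteMeasure_refOutputMeasure h0 h1 N
  set Q := refOutputMeasure ε N with hQ
  have hQ0 := refOutputMeasure_singleton_ne_zero h0 h1 N
  have h := measure_eq_withDensity_nat (poissonMeasure x) Q hQ0
  have hac : poissonMeasure x ≪ Q := by
    rw [h]; exact withDensity_absolutelyContinuous _ _
  have hrn : (poissonMeasure x).rnDeriv Q =ᵐ[Q] fun y => poissonMeasure x {y} / Q {y} := by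
    conv_lhs => rw [h]
    exact Measure.rnDeriv_withDensity _ Measurable.of_discrete
  have hllr : llr (poissonMeasure x) Q =ᵐ[poissonMeasure x]
      fun y => Real.log (weight x y / refOutput ε N y) := by
    filter_upwards [hac.ae_le hrn] with y hy
    rw [llr, hy, poissonMeasure_singleton_eq, hQ, refOutputMeasure_singleton,
      ENNReal.toReal_div, ENNReal.toReal_ofReal (weight_nonneg x y),
      ENNReal.toReal_ofReal (refOutput_pos h0 h1 N y).le]
  rw [klDiv_of_ac_of_integrable hac
    ((integrable_congr hllr).2 (integrable_log_div_refOutput h0 h1 N x)),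
    integral_congr_ae hllr]
  refine ENNReal.ofReal_le_ofReal ?_
  have hu : Q.real Set.univ ≤ 1 :=
    ENNReal.toReal_le_of_le_ofReal zero_le_one
      (by simpa using refOutputMeasure_univ_le h0 h1 N)
  rw [probReal_univ (μ := poissonMeasure x)]
  linarith

/-- Below N the main component of the mixture suffices. From N on, y - x ≥ N - A > 0, so the
logarithmic cost of the heavy tail is dominated by a small multiple of (y-x)², whose Poisson mean is
only x ≤ A. -/
lemma neg_log_refOutput_le_add {ε : ℝ} (h0 : 0 < ε) (h1 : ε < 1) {N : ℕ} {A : ℝ} (hA : 0 ≤ A)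
    (hN : A < N) {x : ℝ} (hx : x ≤ A) (y : ℕ) :
    -Real.log (refOutput ε N y) ≤ -Real.log (refWeight y) + (Real.log N / 2 - Real.log (1 - ε))
      + ((-Real.log ε + 2 * Real.log (A + 2)) / (N - A) ^ 2 + 2 / ((N - A) * (A + 2)))
        * ((y : ℝ) - x) ^ 2 := by
  have hw := refWeight_pos y
  have hε : 0 < 1 - ε := by linarith
  have hNA : 0 < N - A := by linarith
  have hN0 : (0 : ℝ) < N := by linarith
  have hl1 := Real.log_nonpos h0.le h1.le
  have hl2 := Real.log_nonneg (show 1 ≤ A + 2 by linarith)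
  rcases lt_or_ge y N with hy | hy
  · have h2 : (1 - ε) * (refWeight y / √N) ≤ refOutput ε N y := by
      rw [refOutput, if_pos hy]
      have : 0 ≤ ε / (((y : ℝ) + 1) * (y + 2)) := by positivity
      linarith
    have h3 := Real.log_le_log (by positivity) h2
    rw [Real.log_mul hε.ne' (by positivity), Real.log_div hw.ne' (by positivity),
      Real.log_sqrt hN0.le] at h3
    have h4 : 0 ≤ ((-Real.log ε + 2 * Real.log (A + 2)) / (N - A) ^ 2
        + 2 / ((N - A) * (A + 2))) * ((y : ℝ) - x) ^ 2 := by
      have : 0 ≤ -Real.log ε + 2 * Real.log (A + 2) := by linarith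
      positivity
    linarith
  · have hy' : (N : ℝ) ≤ y := by exact_mod_cast hy
    have h2 := neg_log_refOutput_le h0 h1 N y
    have h3 : 0 ≤ -Real.log (refWeight y) := by
      have := Real.log_nonpos hw.le (refWeight_le_one y); linarith
    have h4 : 0 ≤ Real.log N / 2 := by
      have := Real.log_natCast_nonneg N; linarith
    have h5 : 0 ≤ -Real.log (1 - ε) := by
      have := Real.log_nonpos hε.le (by linarith); linarith
    have h6 : 1 ≤ ((y : ℝ) - x) ^ 2 / (N - A) ^ 2 := by
      rw [one_le_div (by positivity)]
      exact pow_le_pow_left₀ hNA.le (by linarith) 2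
    have h7 : Real.log ((y : ℝ) + 2) ≤ Real.log (A + 2) +
        ((y : ℝ) - x) ^ 2 / ((N - A) * (A + 2)) := by
      have h8 := Real.log_le_sub_one_of_pos (x := ((y : ℝ) + 2) / (A + 2)) (by positivity)
      rw [Real.log_div (by positivity) (by positivity)] at h8
      have h9 : ((y : ℝ) + 2) / (A + 2) - 1 ≤ ((y : ℝ) - x) ^ 2 / ((N - A) * (A + 2)) := by
        rw [div_sub_one (by positivity), div_le_div_iff₀ (by positivity) (by positivity)]
        have h10 : ((y : ℝ) + 2 - (A + 2)) * (N - A) ≤ ((y : ℝ) - x) ^ 2 := by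
          rw [pow_two]
          exact mul_le_mul (by linarith) (by linarith) hNA.le (by linarith)
        nlinarith
      linarith
    have h11 : -Real.log ε + 2 * Real.log (A + 2) ≤
        (-Real.log ε + 2 * Real.log (A + 2)) * (((y : ℝ) - x) ^ 2 / (N - A) ^ 2) :=
      le_mul_of_one_le_right (by linarith) h6
    have e : ((-Real.log ε + 2 * Real.log (A + 2)) / (N - A) ^ 2 + 2 / ((N - A) * (A + 2)))
        * ((y : ℝ) - x) ^ 2 =
        (-Real.log ε + 2 * Real.log (A + 2)) * (((y : ℝ) - x) ^ 2 / (N - A) ^ 2) +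
        2 * (((y : ℝ) - x) ^ 2 / ((N - A) * (A + 2))) := by ring
    rw [e]
    linarith

end PoissonChannel

/-! ### A uniform divergence bound, and closeness of optimal outputs to the reference law -/

namespace PoissonChannel

lemma integral_log_div_refOutput_le {ε : ℝ} (h0 : 0 < ε) (h1 : ε < 1) {N : ℕ} {A : ℝ≥0}
    (hN : (A : ℝ) < N) {x : ℝ≥0} (hx0 : 0 < x) (hx : x ≤ A) :
    ∫ y, Real.log (weight x y / refOutput ε N y) ∂(poissonMeasure x) ≤
      ∫ y, (Real.log (weight x y) - Real.log (refWeight y)) ∂(poissonMeasure x)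
      + (Real.log N / 2 - Real.log (1 - ε))
      + ((-Real.log ε + 2 * Real.log (A + 2)) / (N - A) ^ 2 + 2 / ((N - A) * (A + 2))) * A := by
  set b := Real.log N / 2 - Real.log (1 - ε)
  set c := (-Real.log ε + 2 * Real.log (A + 2)) / (N - A) ^ 2 + 2 / ((N - A) * ((A : ℝ) + 2))
  have hc : 0 ≤ c := by
    have hl1 := Real.log_nonpos h0.le h1.le
    have hl2 := Real.log_nonneg (show (1 : ℝ) ≤ A + 2 by linarith [A.coe_nonneg])
    have h3 : 0 ≤ -Real.log ε + 2 * Real.log (A + 2) := by linarith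
    have h4 : 0 < (N : ℝ) - A := by linarith
    simp only [c]
    positivity
  have hi := integrable_log_weight_sub hx0
  have hi2 : Integrable (fun y : ℕ => Real.log (weight x y) - Real.log (refWeight y) + b)
      (poissonMeasure x) := hi.add (integrable_const b)
  have hs := (integrable_sq_sub_poisson x).const_mul c
  have hxA : (x : ℝ) ≤ A := hx
  calc _ ≤ ∫ y : ℕ, (Real.log (weight x y) - Real.log (refWeight y) + b
        + c * ((y : ℝ) - x) ^ 2) ∂(poissonMeasure x) := by
        refine integral_mono (integrable_log_div_refOutput h0 h1 N x) (hi2.add hs) fun y => ?_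
        have h2 := neg_log_refOutput_le_add h0 h1 A.coe_nonneg hN hxA y
        change _ ≤ -Real.log (refWeight y) + b + c * ((y : ℝ) - x) ^ 2 at h2
        simp only
        rw [Real.log_div (weight_pos hx0 y).ne' (refOutput_pos h0 h1 N y).ne']
        linarith
    _ = ∫ y, (Real.log (weight x y) - Real.log (refWeight y)) ∂(poissonMeasure x)
          + b + c * x := by
        rw [integral_add hi2 hs, integral_add hi (integrable_const b), integral_const_mul,
          integral_sq_sub_poisson]
        simp
    _ ≤ _ := by gcongr

/-- A crude bound independent of N, from the heavy-tailed component alone. It handles small inputs,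
where no asymptotics are available. -/
lemma integral_log_div_refOutput_le_of_le {ε : ℝ} (h0 : 0 < ε) (h1 : ε < 1) (N : ℕ) (x : ℝ≥0) :
    ∫ y, Real.log (weight x y / refOutput ε N y) ∂(poissonMeasure x) ≤
      -Real.log ε + 2 * (x + 1) := by
  have hi := ((integrable_cast_poisson x).fun_add (integrable_const (1 : ℝ))).const_mul 2
  calc _ ≤ ∫ y : ℕ, (-Real.log ε + 2 * ((y : ℝ) + 1)) ∂(poissonMeasure x) := by
        refine integral_mono (integrable_log_div_refOutput h0 h1 N x)
          ((integrable_const _).add hi) fun y => ?_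
        have hq := refOutput_pos h0 h1 N y
        have h2 := neg_log_refOutput_le h0 h1 N y
        have h3 := Real.log_le_sub_one_of_pos (x := (y : ℝ) + 2) (by positivity)
        have h4 := Real.log_nonpos hq.le (refOutput_le_one h0 h1 N y)
        simp only
        rcases (weight_nonneg x y).eq_or_lt with hw | hw
        · rw [← hw, zero_div, Real.log_zero]; linarith
        · rw [Real.log_div hw.ne' hq.ne']
          have := Real.log_nonpos hw.le (weight_le_one x y)
          linarith
    _ = _ := by
        rw [integral_add (integrable_const _) hi, integral_const_mul,
          integral_add (integrable_cast_poisson x) (integrable_const _), integral_cast_poisson]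
        simp

/-- The cut-off of the reference output law. -/
noncomputable def refCutoff (ε : ℝ) (A : ℝ≥0) : ℕ := ⌈(1 + ε) * (A : ℝ)⌉₊

lemma mul_le_refCutoff_sub {ε : ℝ} (A : ℝ≥0) : ε * A ≤ (refCutoff ε A : ℝ) - A := by
  have := Nat.le_ceil ((1 + ε) * (A : ℝ))
  unfold refCutoff
  linarith

lemma refCutoff_le {ε : ℝ} (h0 : 0 < ε) {A : ℝ≥0} (hA : 1 / ε ≤ (A : ℝ)) :
    (refCutoff ε A : ℝ) ≤ (1 + 2 * ε) * A := by
  have h1 : 0 ≤ (1 + ε) * (A : ℝ) := by positivity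
  have h2 := (Nat.ceil_lt_add_one h1).le
  rw [div_le_iff₀ h0] at hA
  unfold refCutoff
  nlinarith

lemma tendsto_log_add_two_div :
    Filter.Tendsto (fun A : ℝ≥0 => Real.log ((A : ℝ) + 2) / A) Filter.atTop (nhds 0) := by
  have h := Real.tendsto_pow_log_div_mul_add_atTop 1 (-2) 1 one_ne_zero
  have h2 : Filter.Tendsto (fun A : ℝ≥0 => (A : ℝ) + 2) Filter.atTop Filter.atTop :=
    Filter.tendsto_atTop_add_const_right _ _ (NNReal.tendsto_coe_atTop.2 Filter.tendsto_id)
  refine (h.comp h2).congr fun A => ?_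
  simp

/-- For inputs below K the crude bound is a constant, eventually beaten by (log A)/2. For the others
the slack 5ε is made of ε from the limit, ε from (log N)/2, 2ε from -log(1-ε), and ε from the tail
beyond N. -/
lemma eventually_klDiv_poisson_le {ε : ℝ} (h0 : 0 < ε) (h1 : ε ≤ 1 / 2) :
    ∀ᶠ A : ℝ≥0 in Filter.atTop, ∀ x ≤ A,
      klDiv (poissonMeasure x) (refOutputMeasure ε (refCutoff ε A)) ≤
        ENNReal.ofReal (Real.log A / 2 + capacityConst + 5 * ε) := by
  have hε1 : ε < 1 := by linarith
  obtain ⟨K, hK⟩ := Filter.eventually_atTop.1 (tendsto_integral_log_weight_sub.eventually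
    (gt_mem_nhds (show capacityConst < capacityConst + ε by linarith)))
  have hlog : Filter.Tendsto (fun A : ℝ≥0 => Real.log A / 2 + capacityConst) Filter.atTop
      Filter.atTop :=
    Filter.tendsto_atTop_add_const_right _ _ ((Real.tendsto_log_atTop.comp
      (NNReal.tendsto_coe_atTop.2 Filter.tendsto_id)).atTop_div_const two_pos)
  have hsmall : Filter.Tendsto (fun A : ℝ≥0 =>
      (-Real.log ε * (A : ℝ)⁻¹ + 2 * (Real.log ((A : ℝ) + 2) / A)) / ε ^ 2
        + 2 / ε * (A : ℝ)⁻¹) Filter.atTop (nhds 0) := by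
    simpa using (((tendsto_inv_coe_nnreal.const_mul (-Real.log ε)).add
      (tendsto_log_add_two_div.const_mul 2)).div_const (ε ^ 2)).add
      (tendsto_inv_coe_nnreal.const_mul (2 / ε))
  have hlarge : Filter.Tendsto (fun A : ℝ≥0 => (A : ℝ)) Filter.atTop Filter.atTop :=
    NNReal.tendsto_coe_atTop.2 Filter.tendsto_id
  filter_upwards [Filter.eventually_gt_atTop 0, hsmall.eventually (gt_mem_nhds h0),
    hlog.eventually_ge_atTop (-Real.log ε + 2 * (K + 1)), hlarge.eventually_ge_atTop (1 / ε)]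
    with A hA hA1 hA2 hA3 x hx
  refine (klDiv_poisson_refOutput_le h0 hε1 _ x).trans (ENNReal.ofReal_le_ofReal ?_)
  have hA' : (0 : ℝ) < A := hA
  rcases lt_or_ge 0 x with hx0 | hx0
  swap
  · have h2 := integral_log_div_refOutput_le_of_le h0 hε1 (refCutoff ε A) x
    have hx1 : (x : ℝ) ≤ 0 := hx0
    linarith [K.coe_nonneg]
  rcases lt_or_ge x K with hxK | hxK
  · have h2 := integral_log_div_refOutput_le_of_le h0 hε1 (refCutoff ε A) x
    have hx1 : (x : ℝ) < K := hxK
    linarith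
  have hΔ := mul_le_refCutoff_sub (ε := ε) A
  have hΔ0 : 0 < ε * A := by positivity
  have hN : (A : ℝ) < refCutoff ε A := by linarith
  have h2 := integral_log_div_refOutput_le h0 hε1 hN hx0 hx
  have h3 := hK x hxK
  have h4 : Real.log (refCutoff ε A) ≤ 2 * ε + Real.log A := by
    calc Real.log (refCutoff ε A) ≤ Real.log ((1 + 2 * ε) * A) :=
          Real.log_le_log (by linarith) (refCutoff_le h0 hA3)
      _ = Real.log (1 + 2 * ε) + Real.log A := Real.log_mul (by positivity) hA'.ne'
      _ ≤ _ := by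
          have := Real.log_le_sub_one_of_pos (x := 1 + 2 * ε) (by positivity)
          linarith
  have h5 : -Real.log (1 - ε) ≤ 2 * ε := by
    have h6 := Real.one_sub_inv_le_log_of_pos (x := 1 - ε) (by linarith)
    have h7 : (1 - ε)⁻¹ ≤ 1 + 2 * ε := by
      rw [inv_le_iff_one_le_mul₀ (by linarith)]
      nlinarith
    linarith
  have hl1 := Real.log_nonpos h0.le hε1.le
  have hl2 := Real.log_nonneg (show (1 : ℝ) ≤ A + 2 by linarith)
  have h8 : ((-Real.log ε + 2 * Real.log (A + 2)) / (refCutoff ε A - A) ^ 2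
      + 2 / ((refCutoff ε A - A) * ((A : ℝ) + 2))) * A ≤ ε := by
    refine le_trans ?_ hA1.le
    have hb : 0 ≤ -Real.log ε + 2 * Real.log (A + 2) := by linarith
    calc _ ≤ ((-Real.log ε + 2 * Real.log (A + 2)) / (ε * A) ^ 2
          + 2 / ((ε * A) * (A : ℝ))) * A := by
          gcongr
          linarith
      _ = _ := by field_simp
  linarith

/-- In the compensation identity the average divergence is at most s + t, and the mutual information
already uses up s. -/
lemma klDiv_output_le {A : ℝ≥0} {P : Measure ℝ≥0} (hP : IsAdmissible A P) {Q : Measure ℕ}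
    [IsFiniteMeasure Q] (hQ : ∀ y, Q {y} ≠ 0) {s t : ℝ} (ht : 0 ≤ t)
    (hst : ∀ x ≤ A, klDiv (poissonMeasure x) Q ≤ ENNReal.ofReal (s + t))
    (hI : ENNReal.ofReal s ≤ mutualInformation P) (hs : 0 ≤ s) :
    klDiv (output P) Q ≤ ENNReal.ofReal t := by
  have := hP.isProbabilityMeasure
  have h1 := klDiv_joint_prod_eq_add P Q
  rw [klDiv_joint_prod_eq P Q hQ] at h1
  have h2 : ∫⁻ x, klDiv (poissonMeasure x) Q ∂P ≤ ENNReal.ofReal (s + t) := by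
    calc _ ≤ ∫⁻ _, ENNReal.ofReal (s + t) ∂P :=
          lintegral_mono_ae (hP.le_amplitude.mono fun x hx => hst x hx)
      _ = _ := by simp
  rw [h1, add_comm s t, ENNReal.ofReal_add ht hs] at h2
  exact (ENNReal.add_le_add_iff_right ENNReal.ofReal_ne_top).1
    ((add_le_add le_rfl hI).trans h2)

lemma eventually_klDiv_output_le {ε : ℝ} (h0 : 0 < ε) (h1 : ε ≤ 1 / 2) :
    ∀ᶠ A : ℝ≥0 in Filter.atTop, ∀ P, IsCapacityAchieving A P →
      klDiv (output P) (refOutputMeasure ε (refCutoff ε A)) ≤ ENNReal.ofReal (6 * ε) := by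
  have hlog : Filter.Tendsto (fun A : ℝ≥0 => Real.log A / 2 + capacityConst) Filter.atTop
      Filter.atTop :=
    Filter.tendsto_atTop_add_const_right _ _ ((Real.tendsto_log_atTop.comp
      (NNReal.tendsto_coe_atTop.2 Filter.tendsto_id)).atTop_div_const two_pos)
  filter_upwards [eventually_klDiv_poisson_le h0 h1, eventually_le_capacity h0,
    hlog.eventually_ge_atTop ε] with A hA1 hA2 hA3 P hP
  have hε1 : ε < 1 := by linarith
  have := isFiniteMeasure_refOutputMeasure h0 hε1 (refCutoff ε A)
  refine klDiv_output_le hP.admissible (refOutputMeasure_singleton_ne_zero h0 hε1 _)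
    (s := Real.log A / 2 + capacityConst - ε) (by linarith) (fun x hx => ?_)
    (hP.mutualInformation_eq ▸ hA2) (by linarith)
  convert hA1 x hx using 2
  ring

end PoissonChannel

namespace PoissonChannel

/-! ### The output law of capacity-achieving inputs -/

/-- Squared Hellinger distance is at most relative entropy, pointwise: use log √z ≥ 1 - 1/√z. -/
lemma sq_sqrt_sub_one_le_klFun {z : ℝ} (hz : 0 ≤ z) : (√z - 1) ^ 2 ≤ klFun z := by
  have hs := Real.sq_sqrt hz
  rw [klFun_apply]
  rcases hz.eq_or_lt with rfl | hz'
  · simp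
  have h1 : 0 < √z := Real.sqrt_pos.2 hz'
  have h2 := Real.one_sub_inv_le_log_of_pos h1
  rw [Real.log_sqrt hz] at h2
  have h3 := mul_le_mul_of_nonneg_left h2 hz
  have h4 : z * (1 - (√z)⁻¹) = z - √z := by
    have : z * (√z)⁻¹ = √z := by rw [← div_eq_mul_inv, Real.div_sqrt]
    rw [mul_sub, this, mul_one]
  nlinarith

/-- A linearized form of Pinsker's inequality. -/
lemma abs_sub_one_le_klFun {z η : ℝ} (hz : 0 ≤ z) (hη : 0 < η) :
    |z - 1| ≤ η + (1 + 1 / η) * klFun z := by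
  have h := sq_sqrt_sub_one_le_klFun hz
  have hs := Real.sq_sqrt hz
  set u := |√z - 1|
  have hu : u ^ 2 = (√z - 1) ^ 2 := sq_abs _
  have h1 : |z - 1| ≤ 2 * u + u ^ 2 := by
    have e : z - 1 = (√z - 1) * 2 + (√z - 1) * (√z - 1) := by nlinarith
    calc |z - 1| ≤ |(√z - 1) * 2| + |(√z - 1) * (√z - 1)| := e ▸ abs_add_le _ _
      _ = 2 * u + u ^ 2 := by rw [abs_mul, abs_mul, abs_two]; ring
  have h2 : 2 * u ≤ η + 1 / η * u ^ 2 := by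
    have e : η + 1 / η * u ^ 2 - 2 * u = (η - u) ^ 2 / η := by field_simp; ring
    have : 0 ≤ (η - u) ^ 2 / η := by positivity
    linarith
  have h3 : (1 + 1 / η) * u ^ 2 ≤ (1 + 1 / η) * klFun z := by
    rw [hu]; gcongr
  linarith

lemma tsum_abs_sub_refOutput_le {ε : ℝ} (h0 : 0 < ε) (h1 : ε < 1) {N : ℕ} {μ : Measure ℕ}
    [IsProbabilityMeasure μ] {t : ℝ} (ht : 0 ≤ t)
    (hμ : klDiv μ (refOutputMeasure ε N) ≤ ENNReal.ofReal t) {η : ℝ} (hη : 0 < η) :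
    ∑' y, ENNReal.ofReal |μ.real {y} - refOutput ε N y| ≤
      ENNReal.ofReal (η + (1 + 1 / η) * t) := by
  have := isFiniteMeasure_refOutputMeasure h0 h1 N
  rw [klDiv_nat_eq _ _ (refOutputMeasure_singleton_ne_zero h0 h1 N), lintegral_countable'] at hμ
  simp_rw [refOutputMeasure_singleton] at hμ
  have hpt : ∀ y, ENNReal.ofReal |μ.real {y} - refOutput ε N y| ≤
      ENNReal.ofReal η * ENNReal.ofReal (refOutput ε N y) + ENNReal.ofReal (1 + 1 / η) *
        (ENNReal.ofReal (klFun (μ {y} / ENNReal.ofReal (refOutput ε N y)).toReal) *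
          ENNReal.ofReal (refOutput ε N y)) := by
    intro y
    have hq := refOutput_pos h0 h1 N y
    rw [ENNReal.toReal_div, ENNReal.toReal_ofReal hq.le]
    change _ ≤ _ + _ * (ENNReal.ofReal (klFun (μ.real {y} / _)) * _)
    have hz : 0 ≤ μ.real {y} / refOutput ε N y := by positivity
    have hk := klFun_nonneg hz
    rw [← ENNReal.ofReal_mul hk, ← ENNReal.ofReal_mul hη.le, ← ENNReal.ofReal_mul (by positivity),
      ← ENNReal.ofReal_add (by positivity) (by positivity)]
    refine ENNReal.ofReal_le_ofReal ?_
    have h := mul_le_mul_of_nonneg_right (abs_sub_one_le_klFun hz hη) hq.le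
    calc |μ.real {y} - refOutput ε N y|
        = |μ.real {y} / refOutput ε N y - 1| * refOutput ε N y := by
          rw [div_sub_one hq.ne', abs_div, abs_of_pos hq, div_mul_cancel₀ _ hq.ne']
      _ ≤ _ := h
      _ = _ := by ring
  calc _ ≤ _ := ENNReal.tsum_le_tsum hpt
    _ ≤ ENNReal.ofReal η * 1 + ENNReal.ofReal (1 + 1 / η) * ENNReal.ofReal t := by
        rw [ENNReal.tsum_add, ENNReal.tsum_mul_left, ENNReal.tsum_mul_left]
        gcongr
        exact tsum_ofReal_refOutput_le h0 h1 N
    _ = _ := by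
        rw [mul_one, ← ENNReal.ofReal_mul (by positivity),
          ← ENNReal.ofReal_add hη.le (by positivity)]

/-- The limiting form `1 / (2 √(A (y + 1)))`, `y < A`, of the optimal output law. -/
noncomputable def limitOutput (A : ℝ≥0) (y : ℕ) : ℝ :=
  if (y : ℝ) < A then refWeight y / √A else 0

lemma limitOutput_nonneg (A : ℝ≥0) (y : ℕ) : 0 ≤ limitOutput A y := by
  have := refWeight_pos y
  unfold limitOutput
  split_ifs <;> positivity

lemma tsum_limitOutput (A : ℝ≥0) :
    ∑' y, ENNReal.ofReal (limitOutput A y) =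
      ENNReal.ofReal ((∑ y ∈ Finset.range ⌈(A : ℝ)⌉₊, refWeight y) / √A) := by
  rw [tsum_eq_sum (s := Finset.range ⌈(A : ℝ)⌉₊), Finset.sum_div,
    ENNReal.ofReal_sum_of_nonneg fun y _ => div_nonneg (refWeight_pos y).le (Real.sqrt_nonneg _)]
  · refine Finset.sum_congr rfl fun y hy => ?_
    rw [limitOutput, if_pos (Nat.lt_ceil.1 (Finset.mem_range.1 hy))]
  · intro y hy
    rw [limitOutput, if_neg fun h => hy (Finset.mem_range.2 (Nat.lt_ceil.2 h)),
      ENNReal.ofReal_zero]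

lemma mul_limitOutput_le_refOutput {ε : ℝ} (h0 : 0 < ε) (h1 : ε < 1) {A : ℝ≥0}
    (hA : 1 / ε ≤ (A : ℝ)) (y : ℕ) :
    (1 - 2 * ε) * limitOutput A y ≤ refOutput ε (refCutoff ε A) y := by
  have hA0 : (0 : ℝ) < A := lt_of_lt_of_le (by positivity) hA
  have hw := refWeight_pos y
  have hpos := refOutput_pos h0 h1 (refCutoff ε A) y
  unfold limitOutput
  split_ifs with hy
  · have hΔ := mul_le_refCutoff_sub (ε := ε) A
    have hΔ0 : 0 < ε * A := by positivity
    have hyN : y < refCutoff ε A := by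
      have : (y : ℝ) < refCutoff ε A := by linarith
      exact_mod_cast this
    have hN0 : (0 : ℝ) < refCutoff ε A := by linarith
    have hsq : √(refCutoff ε A : ℝ) ≤ (1 + ε) * √A := by
      refine Real.sqrt_le_iff.2 ⟨by positivity, ?_⟩
      rw [mul_pow, Real.sq_sqrt hA0.le]
      exact (refCutoff_le h0 hA).trans (by nlinarith)
    have h2 : (1 - ε) * (refWeight y / √(refCutoff ε A : ℝ)) ≤ refOutput ε (refCutoff ε A) y := by
      rw [refOutput, if_pos hyN]
      have : 0 ≤ ε / (((y : ℝ) + 1) * (y + 2)) := by positivity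
      linarith
    refine le_trans ?_ h2
    have h3 : (1 - 2 * ε) / √A ≤ (1 - ε) / √(refCutoff ε A : ℝ) := by
      calc (1 - 2 * ε) / √A ≤ (1 - ε) / ((1 + ε) * √A) := by
            rw [div_le_div_iff₀ (by positivity) (by positivity)]
            have : 0 < √(A : ℝ) := by positivity
            nlinarith [mul_pos (mul_pos h0 h0) this]
        _ ≤ _ := by
            have : 0 ≤ 1 - ε := by linarith
            gcongr
    calc _ = (1 - 2 * ε) / √A * refWeight y := by ring
      _ ≤ (1 - ε) / √(refCutoff ε A : ℝ) * refWeight y := by gcongr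
      _ = _ := by ring
  · simpa using hpos.le

/-- A Scheffé argument: the reference law is at least (1-2ε) times the limit law and has total mass
at most 1, while the limit law has mass at least 1 - 1/√A, so little room is left for an excess. -/
lemma tsum_abs_refOutput_sub_le {ε : ℝ} (h0 : 0 < ε) (h1 : ε ≤ 1 / 4) {A : ℝ≥0}
    (hA : 1 / ε ≤ (A : ℝ)) :
    ∑' y, ENNReal.ofReal |refOutput ε (refCutoff ε A) y - limitOutput A y| ≤
      ENNReal.ofReal (4 * ε + 1 / √A) := by
  have hε1 : ε < 1 := by linarith
  have hA0 : (0 : ℝ) < A := lt_of_lt_of_le (by positivity) hA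
  set S : ℝ := (∑ y ∈ Finset.range ⌈(A : ℝ)⌉₊, refWeight y) / √A with hS
  have hS0 : 0 ≤ S := div_nonneg (Finset.sum_nonneg fun y _ => (refWeight_pos y).le)
    (Real.sqrt_nonneg _)
  have hS1 : 1 - 1 / √A ≤ S := by
    rw [hS, le_div_iff₀ (by positivity), sub_mul, one_mul, one_div_mul_cancel (by positivity)]
    refine le_trans ?_ (le_sum_refWeight _)
    have : √(A : ℝ) ≤ √((⌈(A : ℝ)⌉₊ : ℝ) + 1) :=
      Real.sqrt_le_sqrt (by linarith [Nat.le_ceil (A : ℝ)])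
    linarith
  have hpt : ∀ y, ENNReal.ofReal |refOutput ε (refCutoff ε A) y - limitOutput A y| +
      ENNReal.ofReal (1 - 2 * ε) * ENNReal.ofReal (limitOutput A y) ≤
      ENNReal.ofReal (refOutput ε (refCutoff ε A) y) +
        ENNReal.ofReal (2 * ε) * ENNReal.ofReal (limitOutput A y) := by
    intro y
    have hF := limitOutput_nonneg A y
    have hQ := refOutput_pos h0 hε1 (refCutoff ε A) y
    have h3 : 0 ≤ 1 - 2 * ε := by linarith
    rw [← ENNReal.ofReal_mul h3, ← ENNReal.ofReal_mul (by positivity),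
      ← ENNReal.ofReal_add (abs_nonneg _) (by positivity),
      ← ENNReal.ofReal_add hQ.le (by positivity)]
    refine ENNReal.ofReal_le_ofReal ?_
    have h2 := mul_limitOutput_le_refOutput h0 hε1 hA y
    have h4 : 0 ≤ ε * limitOutput A y := by positivity
    rcases abs_cases (refOutput ε (refCutoff ε A) y - limitOutput A y) with h | h <;>
      rw [h.1] <;> nlinarith
  have hsum := ENNReal.tsum_le_tsum hpt
  rw [ENNReal.tsum_add, ENNReal.tsum_add, ENNReal.tsum_mul_left, ENNReal.tsum_mul_left,
    tsum_limitOutput, ← hS] at hsum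
  have h3 : 0 ≤ 1 - 2 * ε := by linarith
  have hsum2 := hsum.trans (add_le_add_left (tsum_ofReal_refOutput_le h0 hε1 _) _)
  rw [← ENNReal.ofReal_one, ← ENNReal.ofReal_mul h3, ← ENNReal.ofReal_mul (by positivity),
    ← ENNReal.ofReal_add zero_le_one (by positivity)] at hsum2
  have h5 := ENNReal.le_sub_of_add_le_right ENNReal.ofReal_ne_top hsum2
  rw [← ENNReal.ofReal_sub _ (by positivity)] at h5
  refine h5.trans (ENNReal.ofReal_le_ofReal ?_)
  have h6 : 0 < 1 / √(A : ℝ) := by positivity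
  nlinarith

/-- The output laws of capacity-achieving inputs approach `limitOutput` in total variation. -/
lemma eventually_tsum_abs_output_sub_le {τ : ℝ} (hτ : 0 < τ) :
    ∀ᶠ A : ℝ≥0 in Filter.atTop, ∀ P, IsCapacityAchieving A P →
      ∑' y, ENNReal.ofReal |(output P).real {y} - limitOutput A y| ≤ ENNReal.ofReal τ := by
  -- The reference law is used with ε = η², so that the linearized Pinsker bound η + (1 + 1/η) · 6ε
  -- is O(η).
  set η : ℝ := min (1 / 2) (τ / 20) with hη
  have hη0 : 0 < η := by positivity
  have hη1 : η ≤ 1 / 2 := min_le_left _ _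
  have hη2 : η ≤ τ / 20 := min_le_right _ _
  have hε0 : 0 < η ^ 2 := by positivity
  have hε1 : η ^ 2 ≤ 1 / 4 := by nlinarith
  have hlarge : Filter.Tendsto (fun A : ℝ≥0 => (A : ℝ)) Filter.atTop Filter.atTop :=
    NNReal.tendsto_coe_atTop.2 Filter.tendsto_id
  filter_upwards [eventually_klDiv_output_le hε0 (by linarith),
    hlarge.eventually_ge_atTop (1 / η ^ 2)] with A hA hA1 P hP
  have := hP.admissible.isProbabilityMeasure
  have hA0 : (0 : ℝ) < A := lt_of_lt_of_le (by positivity) hA1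
  have h1 := tsum_abs_sub_refOutput_le hε0 (by linarith) (by positivity) (hA P hP) hη0
  have h2 := tsum_abs_refOutput_sub_le hε0 hε1 hA1
  have h3 : 1 / √(A : ℝ) ≤ η := by
    rw [div_le_iff₀ (by positivity), ← div_le_iff₀' hη0]
    refine Real.le_sqrt_of_sq_le ?_
    rwa [div_pow, one_pow]
  calc _ ≤ ∑' y, (ENNReal.ofReal |(output P).real {y} - refOutput (η ^ 2) (refCutoff (η ^ 2) A) y|
        + ENNReal.ofReal |refOutput (η ^ 2) (refCutoff (η ^ 2) A) y - limitOutput A y|) := by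
        refine ENNReal.tsum_le_tsum fun y => ?_
        rw [← ENNReal.ofReal_add (abs_nonneg _) (abs_nonneg _)]
        exact ENNReal.ofReal_le_ofReal (abs_sub_le _ _ _)
    _ ≤ ENNReal.ofReal (η + (1 + 1 / η) * (6 * η ^ 2)) + ENNReal.ofReal (4 * η ^ 2 + 1 / √A) := by
        rw [ENNReal.tsum_add]
        exact add_le_add h1 h2
    _ ≤ _ := by
        rw [← ENNReal.ofReal_add (by positivity) (by positivity)]
        refine ENNReal.ofReal_le_ofReal ?_
        have e : (1 + 1 / η) * (6 * η ^ 2) = 6 * η ^ 2 + 6 * η := by field_simp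
        rw [e]
        nlinarith

end PoissonChannel

namespace PoissonChannel

/-! ### Posterior probabilities under a locally flat output law -/

/-- The Christoffel function of the span of `v⁻¹, 1, v` for the log-normal moments
`𝔼 v ^ i = a ^ (i ^ 2)` is at most `(a ^ 2 + 1) / (a ^ 2 + 2)`. -/
lemma exists_test_polynomial {a e v : ℝ} (ha : 1 < a) (he : 0 < e) (he1 : e ≤ 1)
    (hea : e ≤ (a ^ 2 - 1) ^ 2 / 2) (hv : 0 < v) :
    ∃ p q r : ℝ, p * v + q + r / v = 1 ∧
      r ^ 2 * a ^ 4 + 2 * q * r * a + (q ^ 2 + 2 * p * r) + 2 * p * q * a + p ^ 2 * a ^ 4 ≤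
        (a ^ 2 + 1) / (a ^ 2 + 2) ∧
      |p| ≤ (1 + a) / e ∧ |q| ≤ (1 + a) / e ∧ |r| ≤ (1 + a) / e := by
  have ha2 : 0 < a ^ 2 - 1 := by nlinarith
  -- In L² of the log-normal law, 1, S and C - a are orthogonal with squared norms 1, E and V. Thus
  -- D below is the diagonal of the reproducing kernel at v, and 1/D is the Christoffel function.
  set S := (v - 1 / v) / 2 with hS
  set C := (v + 1 / v) / 2 with hC
  set E := (a ^ 4 - 1) / 2 with hE
  set V := (a ^ 2 - 1) ^ 2 / 2 with hV
  have hCS : S ^ 2 = C ^ 2 - 1 := by rw [hS, hC]; field_simp; ring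
  have hE' : E = (a ^ 2 - 1) * (a ^ 2 + 1) / 2 := by rw [hE]; ring
  have hE0 : 0 < E := by rw [hE']; positivity
  have hV0 : 0 < V := by positivity
  have hVE : V ≤ E := by rw [hE', hV]; nlinarith
  set D := 1 + S ^ 2 / E + (C - a) ^ 2 / V with hD
  have hD1 : 1 ≤ D := by
    have : 0 ≤ S ^ 2 / E + (C - a) ^ 2 / V := by positivity
    rw [hD]; linarith
  have hD0 : 0 < D := by linarith
  have hDlow : (a ^ 2 + 2) / (a ^ 2 + 1) ≤ D := by
    -- Since S² = C² - 1, D is a quadratic polynomial in C; this completes the square, and the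
    -- constant left over is the claimed bound.
    have h : D - (a ^ 2 + 2) / (a ^ 2 + 1) = 4 * a ^ 2 / ((a ^ 2 - 1) ^ 2 * (a ^ 2 + 1))
        * (C - (a ^ 2 + 1) / (2 * a)) ^ 2 := by
      rw [hD, hCS, hE', hV]
      have := ha2.ne'
      field_simp
      ring
    have h2 : 0 ≤ 4 * a ^ 2 / ((a ^ 2 - 1) ^ 2 * (a ^ 2 + 1))
        * (C - (a ^ 2 + 1) / (2 * a)) ^ 2 := by positivity
    linarith
  -- The extremal T is the kernel at v divided by D: its coordinates on 1, S, C - a are 1/D, β, γ,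
  -- its value at v is 1 and its second moment is 1/D.
  set β := S / (E * D) with hβ
  set γ := (C - a) / (V * D) with hγ
  have hsum : (1 / D) ^ 2 + β ^ 2 * E + γ ^ 2 * V = 1 / D := by
    have : (1 / D) ^ 2 + β ^ 2 * E + γ ^ 2 * V
        = (1 + S ^ 2 / E + (C - a) ^ 2 / V) / D ^ 2 := by
      rw [hβ, hγ]; field_simp
    rw [this, ← hD]; field_simp
  have hinv1 : 1 / D ≤ 1 := by rw [div_le_one hD0]; exact hD1
  have hinv0 : 0 < 1 / D := by positivity
  have hone : 1 ≤ 1 / e := by rw [one_le_div he]; exact he1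
  -- The second moment of T is at most 1, so a lower bound e on the squared norms of the basis
  -- controls the coefficients.
  have hbound : ∀ t W : ℝ, e ≤ W → t ^ 2 * W ≤ 1 → |t| ≤ 1 / e := by
    intro t W hW ht
    refine abs_le_of_sq_le_sq ?_ (by positivity)
    have h1 : t ^ 2 * e ≤ 1 := (mul_le_mul_of_nonneg_left hW (sq_nonneg t)).trans ht
    have h2 : t ^ 2 ≤ 1 / e := by rwa [le_div_iff₀ he]
    nlinarith
  have hβb : |β| ≤ 1 / e := hbound β E (hea.trans hVE) (by
    have : 0 ≤ γ ^ 2 * V := by positivity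
    linarith [sq_nonneg (1 / D)])
  have hγb : |γ| ≤ 1 / e := hbound γ V hea (by
    have : 0 ≤ β ^ 2 * E := by positivity
    linarith [sq_nonneg (1 / D)])
  have hM : 1 / e ≤ (1 + a) / e := by gcongr; linarith
  refine ⟨(γ + β) / 2, 1 / D - a * γ, (γ - β) / 2, ?_, ?_, ?_, ?_, ?_⟩
  · have h1 : (γ + β) / 2 * v + (1 / D - a * γ) + (γ - β) / 2 / v =
        1 / D + β * S + γ * (C - a) := by rw [hS, hC]; field_simp; ring
    have h2 : 1 / D + β * S + γ * (C - a) = (1 + S ^ 2 / E + (C - a) ^ 2 / V) / D := by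
      rw [hβ, hγ]; field_simp
    rw [h1, h2, ← hD, div_self hD0.ne']
  · have h1 : ((γ - β) / 2) ^ 2 * a ^ 4 + 2 * (1 / D - a * γ) * ((γ - β) / 2) * a
        + ((1 / D - a * γ) ^ 2 + 2 * ((γ + β) / 2) * ((γ - β) / 2))
        + 2 * ((γ + β) / 2) * (1 / D - a * γ) * a + ((γ + β) / 2) ^ 2 * a ^ 4
        = (1 / D) ^ 2 + β ^ 2 * E + γ ^ 2 * V := by rw [hE, hV]; ring
    rw [h1, hsum, div_le_div_iff₀ hD0 (by positivity), one_mul]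
    rwa [div_le_iff₀ (by positivity), mul_comm] at hDlow
  · rw [abs_div, abs_two]
    have := abs_add_le γ β
    linarith
  · have h1 := abs_sub (1 / D) (a * γ)
    rw [abs_of_pos hinv0, abs_mul, abs_of_pos (by linarith : 0 < a)] at h1
    have h2 : a * |γ| ≤ a * (1 / e) := by gcongr
    have h3 : (1 + a) / e = 1 / e + a * (1 / e) := by ring
    linarith
  · rw [abs_div, abs_two]
    have := abs_sub γ β
    linarith

/-- The normalized ratio `(y + l)! / (y! y ^ l)`. -/
noncomputable def upRatio (y l : ℕ) : ℝ := (y + l).factorial / (y.factorial * (y : ℝ) ^ l)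

/-- The normalized ratio `(y - l)! y ^ l / y!`. -/
noncomputable def downRatio (y l : ℕ) : ℝ := (y - l).factorial * (y : ℝ) ^ l / y.factorial

lemma upRatio_pos {y : ℕ} (hy : 0 < y) (l : ℕ) : 0 < upRatio y l := by
  unfold upRatio; positivity

lemma downRatio_pos {y : ℕ} (hy : 0 < y) (l : ℕ) : 0 < downRatio y l := by
  unfold downRatio; positivity

lemma upRatio_mul_weight (x : ℝ≥0) {y : ℕ} (hy : 0 < y) (l : ℕ) :
    upRatio y l * weight x (y + l) = weight x y * ((x : ℝ) / y) ^ l := by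
  unfold upRatio weight
  rw [pow_add, div_pow]
  field_simp

lemma downRatio_mul_weight {x : ℝ≥0} (hx : 0 < x) {y l : ℕ} (hy : 0 < y) (hl : l ≤ y) :
    downRatio y l * weight x (y - l) = weight x y / ((x : ℝ) / y) ^ l := by
  have hx' : (0 : ℝ) < x := hx
  unfold downRatio weight
  rw [div_pow]
  have : (x : ℝ) ^ y = x ^ (y - l) * x ^ l := by rw [← pow_add, Nat.sub_add_cancel hl]
  rw [this]
  field_simp

/-- The ratio is the product of 1 + i/y for i = 1, …, l; the bounds sum z - z² ≤ log(1+z) ≤ z. -/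
lemma log_upRatio_bounds {y : ℕ} (hy : 0 < y) (l : ℕ) :
    (l : ℝ) * (l + 1) / (2 * y) - l ^ 3 / y ^ 2 ≤ Real.log (upRatio y l) ∧
      Real.log (upRatio y l) ≤ (l : ℝ) * (l + 1) / (2 * y) := by
  have hy' : (0 : ℝ) < y := by exact_mod_cast hy
  induction l with
  | zero => simp [upRatio, Nat.factorial_ne_zero]
  | succ l ih =>
    have hstep : upRatio y (l + 1) = upRatio y l * (1 + ((l : ℝ) + 1) / y) := by
      unfold upRatio
      rw [← add_assoc, Nat.factorial_succ]
      push_cast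
      field_simp
      ring
    have hz : (0 : ℝ) ≤ ((l : ℝ) + 1) / y := by positivity
    have h1 := Real.log_le_sub_one_of_pos (x := 1 + ((l : ℝ) + 1) / y) (by positivity)
    have h2 : ((l : ℝ) + 1) / y - (((l : ℝ) + 1) / y) ^ 2 ≤ Real.log (1 + ((l : ℝ) + 1) / y) := by
      refine le_trans ?_ (Real.one_sub_inv_le_log_of_pos (by positivity))
      set z := ((l : ℝ) + 1) / y
      have : 1 - (1 + z)⁻¹ - (z - z ^ 2) = z ^ 3 / (1 + z) := by field_simp; ring
      have : 0 ≤ z ^ 3 / (1 + z) := by positivity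
      linarith
    rw [hstep, Real.log_mul (upRatio_pos hy l).ne' (by positivity)]
    have e1 : ((l + 1 : ℕ) : ℝ) * ((l + 1 : ℕ) + 1) / (2 * y) =
        (l : ℝ) * (l + 1) / (2 * y) + ((l : ℝ) + 1) / y := by push_cast; field_simp; ring
    have e2 : (l : ℝ) ^ 3 / y ^ 2 + (((l : ℝ) + 1) / y) ^ 2 ≤ ((l + 1 : ℕ) : ℝ) ^ 3 / y ^ 2 := by
      rw [div_pow, ← add_div]
      gcongr
      push_cast
      nlinarith [l.cast_nonneg (α := ℝ)]
    rw [e1]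
    constructor <;> linarith [ih.1, ih.2]

/-- The ratio is the product of 1/(1 - i/y) for i < l; the condition 2l ≤ y keeps i/y ≤ 1/2, where
the quadratic remainder is controlled. -/
lemma log_downRatio_bounds {y l : ℕ} (hy : 0 < y) (hl : 2 * l ≤ y) :
    (l : ℝ) * (l - 1) / (2 * y) ≤ Real.log (downRatio y l) ∧
      Real.log (downRatio y l) ≤ (l : ℝ) * (l - 1) / (2 * y) + 2 * l ^ 3 / y ^ 2 := by
  have hy' : (0 : ℝ) < y := by exact_mod_cast hy
  induction l with
  | zero => simp [downRatio, Nat.factorial_ne_zero]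
  | succ l ih =>
    have ih := ih (by omega)
    have hly : (2 : ℝ) * (l + 1) ≤ y := by exact_mod_cast hl
    have hl0 := l.cast_nonneg (α := ℝ)
    have hpos : (0 : ℝ) < y - l := by linarith
    have hstep : downRatio y (l + 1) = downRatio y l / (1 - (l : ℝ) / y) := by
      unfold downRatio
      have h1 : y - l = (y - (l + 1)) + 1 := by omega
      have h2 : ((y - (l + 1) : ℕ) : ℝ) + 1 = y - l := by
        rw [Nat.cast_sub (by omega)]; push_cast; ring
      rw [h1, Nat.factorial_succ]
      push_cast
      rw [h2, one_sub_div hy'.ne']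
      field_simp
      ring
    set z := (l : ℝ) / y with hz
    have hz0 : 0 ≤ z := by positivity
    have hz1 : z ≤ 1 / 2 := by rw [hz, div_le_iff₀ hy']; linarith
    have h1z : 0 < 1 - z := by linarith
    have h1 := Real.log_le_sub_one_of_pos h1z
    have h2 : -Real.log (1 - z) ≤ z + 2 * z ^ 2 := by
      have h3 := Real.one_sub_inv_le_log_of_pos h1z
      have h4 : (1 - z)⁻¹ ≤ 1 + z + 2 * z ^ 2 := by
        rw [inv_le_iff_one_le_mul₀ h1z]
        nlinarith [mul_nonneg (sq_nonneg z) (by linarith : 0 ≤ 1 - 2 * z)]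
      linarith
    rw [hstep, Real.log_div (downRatio_pos hy l).ne' h1z.ne']
    have e1 : ((l + 1 : ℕ) : ℝ) * ((l + 1 : ℕ) - 1) / (2 * y) =
        (l : ℝ) * (l - 1) / (2 * y) + z := by rw [hz]; push_cast; field_simp; ring
    have e2 : 2 * (l : ℝ) ^ 3 / y ^ 2 + 2 * z ^ 2 ≤ 2 * ((l + 1 : ℕ) : ℝ) ^ 3 / y ^ 2 := by
      rw [hz, div_pow, mul_div_assoc', ← add_div]
      gcongr
      push_cast
      nlinarith
    rw [e1]
    constructor <;> linarith [ih.1, ih.2]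

lemma abs_exp_sub_exp_le {s t ζ : ℝ} (h : |s - t| ≤ ζ) (hζ : ζ ≤ 1) :
    |Real.exp s - Real.exp t| ≤ Real.exp t * (2 * ζ) := by
  have e : Real.exp s - Real.exp t = Real.exp t * (Real.exp (s - t) - 1) := by
    rw [mul_sub, ← Real.exp_add, mul_one, add_sub_cancel]
  rw [e, abs_mul, abs_of_pos (Real.exp_pos t)]
  have h1 := Real.abs_exp_sub_one_le (h.trans hζ)
  gcongr
  linarith

lemma log_refWeight_sub_le {m n : ℕ} (h : m ≤ n) :
    0 ≤ Real.log (refWeight m) - Real.log (refWeight n) ∧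
      Real.log (refWeight m) - Real.log (refWeight n) ≤ ((n : ℝ) - m) / (2 * (m + 1)) := by
  have h' : (m : ℝ) ≤ n := by exact_mod_cast h
  rw [log_refWeight, log_refWeight]
  have h1 : Real.log ((m : ℝ) + 1) ≤ Real.log ((n : ℝ) + 1) :=
    Real.log_le_log (by positivity) (by linarith)
  have h2 := Real.log_le_sub_one_of_pos (x := ((n : ℝ) + 1) / (m + 1)) (by positivity)
  rw [Real.log_div (by positivity) (by positivity)] at h2
  have h3 : ((n : ℝ) - m) / (2 * (m + 1)) = (((n : ℝ) + 1) / (m + 1) - 1) / 2 := by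
    field_simp; ring
  rw [h3]
  constructor <;> linarith

lemma abs_upRatio_sub_le {y l : ℕ} (hy : 0 < y) {ζ : ℝ}
    (hζ : (l : ℝ) / y + 2 * l ^ 3 / y ^ 2 ≤ ζ) (hζ1 : ζ ≤ 1) :
    |upRatio y l * (refWeight (y + l) / refWeight y) - Real.exp ((l : ℝ) ^ 2 / (2 * y))| ≤
      Real.exp ((l : ℝ) ^ 2 / (2 * y)) * (2 * ζ) ∧
    upRatio y l ≤ 3 * Real.exp ((l : ℝ) ^ 2 / (2 * y)) := by
  have hy' : (0 : ℝ) < y := by exact_mod_cast hy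
  have hU := upRatio_pos hy l
  have hw := refWeight_pos y
  have hw2 := refWeight_pos (y + l)
  obtain ⟨h1, h2⟩ := log_upRatio_bounds hy l
  obtain ⟨h3, h4⟩ := log_refWeight_sub_le (show y ≤ y + l by omega)
  have e1 : (l : ℝ) * (l + 1) / (2 * y) = (l : ℝ) ^ 2 / (2 * y) + l / y / 2 := by field_simp
  have hly : 0 ≤ (l : ℝ) / y := by positivity
  have hl3 : 0 ≤ (l : ℝ) ^ 3 / y ^ 2 := by positivity
  have e2 : 2 * (l : ℝ) ^ 3 / y ^ 2 = 2 * (l ^ 3 / y ^ 2) := by ring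
  have h5 : (((y + l : ℕ) : ℝ) - y) / (2 * (y + 1)) ≤ l / y / 2 := by
    push_cast
    rw [add_sub_cancel_left, div_div]
    exact div_le_div_of_nonneg_left (by positivity) (by positivity) (by linarith)
  rw [e1] at h1 h2
  constructor
  · rw [← Real.exp_log (show 0 < upRatio y l * (refWeight (y + l) / refWeight y) by positivity)]
    refine abs_exp_sub_exp_le ?_ hζ1
    rw [Real.log_mul hU.ne' (by positivity), Real.log_div hw2.ne' hw.ne', abs_le]
    constructor <;> linarith
  · rw [← Real.exp_log hU]
    have h6 : Real.exp 1 ≤ 3 := by linarith [Real.exp_one_lt_d9]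
    calc _ ≤ Real.exp (1 + (l : ℝ) ^ 2 / (2 * y)) := Real.exp_le_exp.2 (by linarith)
      _ ≤ _ := by rw [Real.exp_add]; gcongr

lemma abs_downRatio_sub_le {y l : ℕ} (hy : 0 < y) (hl : 2 * l ≤ y) {ζ : ℝ}
    (hζ : (l : ℝ) / y + 2 * l ^ 3 / y ^ 2 ≤ ζ) (hζ1 : ζ ≤ 1) :
    |downRatio y l * (refWeight (y - l) / refWeight y) - Real.exp ((l : ℝ) ^ 2 / (2 * y))| ≤
      Real.exp ((l : ℝ) ^ 2 / (2 * y)) * (2 * ζ) ∧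
    downRatio y l ≤ 3 * Real.exp ((l : ℝ) ^ 2 / (2 * y)) := by
  have hy' : (0 : ℝ) < y := by exact_mod_cast hy
  have hl' : (2 : ℝ) * l ≤ y := by exact_mod_cast hl
  have hl0 := l.cast_nonneg (α := ℝ)
  have hU := downRatio_pos hy l
  have hw := refWeight_pos y
  have hw2 := refWeight_pos (y - l)
  obtain ⟨h1, h2⟩ := log_downRatio_bounds hy hl
  obtain ⟨h3, h4⟩ := log_refWeight_sub_le (show y - l ≤ y by omega)
  have e1 : (l : ℝ) * (l - 1) / (2 * y) = (l : ℝ) ^ 2 / (2 * y) - l / y / 2 := by field_simp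
  have hly : 0 ≤ (l : ℝ) / y := by positivity
  have h5 : ((y : ℝ) - (y - l : ℕ)) / (2 * ((y - l : ℕ) + 1)) ≤ l / y := by
    rw [Nat.cast_sub (by omega), sub_sub_cancel]
    exact div_le_div_of_nonneg_left hl0 hy' (by linarith)
  rw [e1] at h1 h2
  constructor
  · rw [← Real.exp_log
      (show 0 < downRatio y l * (refWeight (y - l) / refWeight y) by positivity)]
    refine abs_exp_sub_exp_le ?_ hζ1
    rw [Real.log_mul hU.ne' (by positivity), Real.log_div hw2.ne' hw.ne', abs_le]
    have : 0 ≤ 2 * (l : ℝ) ^ 3 / y ^ 2 := by positivity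
    constructor <;> linarith
  · rw [← Real.exp_log hU]
    have h6 : Real.exp 1 ≤ 3 := by linarith [Real.exp_one_lt_d9]
    calc _ ≤ Real.exp (1 + (l : ℝ) ^ 2 / (2 * y)) := Real.exp_le_exp.2 (by linarith)
      _ ≤ _ := by rw [Real.exp_add]; gcongr

end PoissonChannel

/-! ### From the test polynomial to a bound on the posterior atoms -/

namespace PoissonChannel

lemma integrable_weight (P : Measure ℝ≥0) [IsProbabilityMeasure P] (y : ℕ) :
    Integrable (fun x => weight x y) P := by
  have hm : Measurable fun x => weight x y := by unfold weight; fun_prop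
  refine (integrable_const (1 : ℝ)).mono' hm.aestronglyMeasurable
    (Filter.Eventually.of_forall fun x => ?_)
  rw [Real.norm_of_nonneg (weight_nonneg x y)]
  exact weight_le_one x y

lemma output_real_singleton (P : Measure ℝ≥0) [IsProbabilityMeasure P] (y : ℕ) :
    (output P).real {y} = ∫ x, weight x y ∂P := by
  rw [measureReal_def, output_singleton, integral_eq_lintegral_of_nonneg_ae
    (Filter.Eventually.of_forall fun x => weight_nonneg x y)
    (integrable_weight P y).aestronglyMeasurable]

/-- A nonnegative combination of transition probabilities bounds the mass of an atom. -/
lemma real_singleton_mul_le (P : Measure ℝ≥0) [IsProbabilityMeasure P] (x : ℝ≥0)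
    (c₀ c₁ c₂ c₃ c₄ : ℝ) (y₀ y₁ y₂ y₃ y₄ : ℕ)
    (h : ∀ x, 0 ≤ c₀ * weight x y₀ + c₁ * weight x y₁ + c₂ * weight x y₂ + c₃ * weight x y₃
      + c₄ * weight x y₄) :
    P.real {x} * (c₀ * weight x y₀ + c₁ * weight x y₁ + c₂ * weight x y₂ + c₃ * weight x y₃
      + c₄ * weight x y₄) ≤
    c₀ * (output P).real {y₀} + c₁ * (output P).real {y₁} + c₂ * (output P).real {y₂}
      + c₃ * (output P).real {y₃} + c₄ * (output P).real {y₄} := by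
  have i₀ := (integrable_weight P y₀).const_mul c₀
  have i₁ := (integrable_weight P y₁).const_mul c₁
  have i₂ := (integrable_weight P y₂).const_mul c₂
  have i₃ := (integrable_weight P y₃).const_mul c₃
  have i₄ := (integrable_weight P y₄).const_mul c₄
  have i := (((i₀.fun_add i₁).fun_add i₂).fun_add i₃).fun_add i₄
  simp_rw [output_real_singleton, ← integral_const_mul]
  rw [← integral_add i₀ i₁, ← integral_add (i₀.fun_add i₁) i₂,
    ← integral_add ((i₀.fun_add i₁).fun_add i₂) i₃,
    ← integral_add (((i₀.fun_add i₁).fun_add i₂).fun_add i₃) i₄]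
  refine le_trans (le_of_eq ?_)
    (setIntegral_le_integral (s := {x}) i (Filter.Eventually.of_forall h))
  rw [integral_singleton, smul_eq_mul]

lemma mul_le_mul_add_abs {κ R f F : ℝ} {m r : ℝ} (hm : |κ| ≤ m) (hR : 0 ≤ R) (hr : R ≤ r) :
    κ * R * f ≤ κ * (R * F) + m * r * |f - F| := by
  have hm0 : 0 ≤ m := (abs_nonneg κ).trans hm
  have h : κ * R * (f - F) ≤ m * r * |f - F| := by
    calc κ * R * (f - F) ≤ |κ * R * (f - F)| := le_abs_self _
      _ = |κ| * R * |f - F| := by rw [abs_mul, abs_mul, abs_of_nonneg hR]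
      _ ≤ _ := by gcongr
  linarith

lemma mul_ratio_le {κ R w w₀ s A m E ζ : ℝ} (hm : |κ| ≤ m) (hw₀ : 0 < w₀) (hA : 0 < s)
    (hT : |R * (w / w₀) - A| ≤ E * (2 * ζ)) :
    κ * (R * (w / s)) ≤ w₀ / s * (κ * A + m * (E * (2 * ζ))) := by
  have h : κ * (R * (w / w₀) - A) ≤ m * (E * (2 * ζ)) := by
    calc κ * (R * (w / w₀) - A) ≤ |κ * (R * (w / w₀) - A)| := le_abs_self _
      _ = |κ| * |R * (w / w₀) - A| := abs_mul _ _
      _ ≤ _ := mul_le_mul hm hT (abs_nonneg _) ((abs_nonneg _).trans hm)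
  have e : κ * (R * (w / s)) = w₀ / s * (κ * A + κ * (R * (w / w₀) - A)) := by
    field_simp; ring
  rw [e]
  gcongr

/-- Every atom has posterior probability at most about `(a ^ 2 + 1) / (a ^ 2 + 2)` at an output
around which the output law is close to `limitOutput`. -/
lemma real_singleton_mul_weight_le (P : Measure ℝ≥0) [IsProbabilityMeasure P] {A : ℝ≥0}
    {y j : ℕ} (hj : 0 < j) (hjy : 4 * j ≤ y) (hyA : ((y + 2 * j : ℕ) : ℝ) < A) {a e ζ B : ℝ}
    (ha : a = Real.exp ((j : ℝ) ^ 2 / (2 * y))) (he : 0 < e) (he1 : e ≤ 1)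
    (hea : e ≤ (a ^ 2 - 1) ^ 2 / 2) (hB : ((1 + a) / e) ^ 2 * a ^ 4 ≤ B)
    (hζ : 2 * (j : ℝ) / y + 16 * j ^ 3 / y ^ 2 ≤ ζ) (hζ1 : ζ ≤ 1) (x : ℝ≥0) :
    P.real {x} * weight x y ≤
      limitOutput A y * ((a ^ 2 + 1) / (a ^ 2 + 2) + 30 * B * ζ) +
      9 * B * (|(output P).real {y - 2 * j} - limitOutput A (y - 2 * j)|
        + |(output P).real {y - j} - limitOutput A (y - j)|
        + |(output P).real {y} - limitOutput A y|
        + |(output P).real {y + j} - limitOutput A (y + j)|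
        + |(output P).real {y + 2 * j} - limitOutput A (y + 2 * j)|) := by
  have hy : 0 < y := by omega
  have hy' : (0 : ℝ) < y := by exact_mod_cast hy
  have hj' : (0 : ℝ) < j := by exact_mod_cast hj
  have hζ0 : 0 ≤ ζ := le_trans (by positivity) hζ
  have ha1 : 1 < a := by rw [ha]; exact Real.one_lt_exp_iff.2 (by positivity)
  have hB0 : 0 ≤ B := le_trans (by positivity) hB
  have hA0 : (0 : ℝ) < A := lt_of_le_of_lt (Nat.cast_nonneg _) hyA
  rcases eq_zero_or_pos x with rfl | hx
  · have h0 : weight 0 y = 0 := by simp [weight, hy.ne']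
    rw [h0, mul_zero]
    have := limitOutput_nonneg A y
    positivity
  have hx' : (0 : ℝ) < x := hx
  -- The polynomial is normalized to be 1 at the atom under consideration, so its square drops out
  -- of the left side of `hmain`.
  obtain ⟨p, q, r, hv, hsum, hp, hq, hr⟩ :=
    exists_test_polynomial ha1 he he1 hea (v := ((x : ℝ) / y) ^ j) (by positivity)
  set M := (1 + a) / e with hM
  have hM0 : 0 ≤ M := (abs_nonneg p).trans hp
  have ha4 : Real.exp (((2 * j : ℕ) : ℝ) ^ 2 / (2 * y)) = a ^ 4 := by
    rw [ha, ← Real.exp_nat_mul]; congr 1; push_cast; ring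
  have hj1 : (j : ℝ) / y + 2 * j ^ 3 / y ^ 2 ≤ ζ := by
    have h1 : 0 ≤ (j : ℝ) / y := by positivity
    have h2 : 0 ≤ (j : ℝ) ^ 3 / y ^ 2 := by positivity
    rw [mul_div_assoc] at hζ ⊢
    rw [mul_div_assoc] at hζ
    linarith
  have hj2 : ((2 * j : ℕ) : ℝ) / y + 2 * (2 * j : ℕ) ^ 3 / y ^ 2 ≤ ζ := by
    refine le_trans (le_of_eq ?_) hζ
    push_cast; ring
  obtain ⟨tU1, bU1⟩ := abs_upRatio_sub_le hy hj1 hζ1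
  obtain ⟨tU2, bU2⟩ := abs_upRatio_sub_le hy hj2 hζ1
  obtain ⟨tD1, bD1⟩ := abs_downRatio_sub_le hy (by omega) hj1 hζ1
  obtain ⟨tD2, bD2⟩ := abs_downRatio_sub_le hy (by omega) hj2 hζ1
  rw [ha4] at tU2 bU2 tD2 bD2
  rw [← ha] at tU1 bU1 tD1 bD1
  have haa : a ≤ a ^ 4 := le_self_pow₀ ha1.le (by norm_num)
  have ha41 : 1 ≤ a ^ 4 := by linarith
  have kmul : ∀ s t : ℝ, |s| ≤ M → |t| ≤ M → |s * t| ≤ M ^ 2 := fun s t hs ht => by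
    rw [abs_mul, pow_two]; exact mul_le_mul hs ht (abs_nonneg _) hM0
  have k0 : |r ^ 2| ≤ 3 * M ^ 2 := by
    have := kmul r r hr hr; rw [← pow_two] at this; linarith [sq_nonneg M]
  have k1 : |2 * q * r| ≤ 3 * M ^ 2 := by
    rw [mul_assoc, abs_mul, abs_two]; linarith [kmul q r hq hr, sq_nonneg M]
  have k2 : |q ^ 2 + 2 * p * r| ≤ 3 * M ^ 2 := by
    have h1 := abs_add_le (q ^ 2) (2 * p * r)
    have h2 := kmul q q hq hq
    have h3 := kmul p r hp hr
    rw [← pow_two] at h2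
    rw [mul_assoc 2 p r, abs_mul 2, abs_two] at h1
    rw [mul_assoc 2 p r]
    linarith
  have k3 : |2 * p * q| ≤ 3 * M ^ 2 := by
    rw [mul_assoc, abs_mul, abs_two]; linarith [kmul p q hp hq, sq_nonneg M]
  have k4 : |p ^ 2| ≤ 3 * M ^ 2 := by
    have := kmul p p hp hp; rw [← pow_two] at this; linarith [sq_nonneg M]
  -- Expanding the square, each power of (x'/y)^j shifts the output by a multiple of j. The
  -- combination of five transition probabilities is thus nonnegative in x'.
  have hid : ∀ x' : ℝ≥0, 0 < x' →
      r ^ 2 * downRatio y (2 * j) * weight x' (y - 2 * j)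
      + 2 * q * r * downRatio y j * weight x' (y - j)
      + (q ^ 2 + 2 * p * r) * 1 * weight x' y
      + 2 * p * q * upRatio y j * weight x' (y + j)
      + p ^ 2 * upRatio y (2 * j) * weight x' (y + 2 * j) =
      weight x' y * (p * ((x' : ℝ) / y) ^ j + q + r / ((x' : ℝ) / y) ^ j) ^ 2 := by
    intro x' hx0
    have hx0' : (0 : ℝ) < x' := hx0
    have d1 := downRatio_mul_weight hx0 hy (show j ≤ y by omega)
    have d2 := downRatio_mul_weight hx0 hy (show 2 * j ≤ y by omega)
    have u1 := upRatio_mul_weight x' hy j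
    have u2 := upRatio_mul_weight x' hy (2 * j)
    rw [pow_mul'] at d2 u2
    have hz : 0 < ((x' : ℝ) / y) ^ j := by positivity
    set z := ((x' : ℝ) / y) ^ j
    rw [mul_assoc (r ^ 2), d2, mul_assoc (2 * q * r), d1, mul_assoc (2 * p * q), u1,
      mul_assoc (p ^ 2), u2]
    field_simp
    ring
  have hmain := real_singleton_mul_le P x (r ^ 2 * downRatio y (2 * j))
    (2 * q * r * downRatio y j) ((q ^ 2 + 2 * p * r) * 1) (2 * p * q * upRatio y j)
    (p ^ 2 * upRatio y (2 * j)) (y - 2 * j) (y - j) y (y + j) (y + 2 * j) (fun x' => by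
      rcases eq_zero_or_pos x' with rfl | hx0
      · have h0 : ∀ n : ℕ, 0 < n → weight 0 n = 0 := fun n hn => by simp [weight, hn.ne']
        rw [h0 _ (by omega), h0 _ (by omega), h0 _ hy, h0 _ (by omega), h0 _ (by omega)]
        simp
      · rw [hid x' hx0]
        exact mul_nonneg (weight_nonneg _ _) (sq_nonneg _))
  rw [hid x hx, hv, one_pow, mul_one] at hmain
  have hs : 0 < √(A : ℝ) := Real.sqrt_pos.2 hA0
  have hF : ∀ n : ℕ, n ≤ y + 2 * j → limitOutput A n = refWeight n / √A := fun n hn => by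
    have hn' : (n : ℝ) ≤ ((y + 2 * j : ℕ) : ℝ) := by exact_mod_cast hn
    rw [limitOutput, if_pos (hn'.trans_lt hyA)]
  have hw := refWeight_pos y
  have g0 := (mul_le_mul_add_abs (f := (output P).real {y - 2 * j})
    (F := limitOutput A (y - 2 * j)) k0 (downRatio_pos hy _).le bD2)
  have g1 := (mul_le_mul_add_abs (f := (output P).real {y - j})
    (F := limitOutput A (y - j)) k1 (downRatio_pos hy _).le
    (bD1.trans (mul_le_mul_of_nonneg_left haa (by norm_num))))
  have g2 := (mul_le_mul_add_abs (f := (output P).real {y}) (R := 1) (r := 3 * a ^ 4)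
    (F := limitOutput A y) k2 zero_le_one (by linarith))
  have g3 := (mul_le_mul_add_abs (f := (output P).real {y + j})
    (F := limitOutput A (y + j)) k3 (upRatio_pos hy _).le
    (bU1.trans (mul_le_mul_of_nonneg_left haa (by norm_num))))
  have g4 := (mul_le_mul_add_abs (f := (output P).real {y + 2 * j})
    (F := limitOutput A (y + 2 * j)) k4 (upRatio_pos hy _).le bU2)
  have eζ : a * (2 * ζ) ≤ a ^ 4 * (2 * ζ) := by gcongr
  have l0 := mul_ratio_le k0 hw hs tD2
  have l1 := mul_ratio_le k1 hw hs (tD1.trans eζ)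
  have l2 := mul_ratio_le (R := 1) (w := refWeight y) (A := 1) (E := a ^ 4) (ζ := ζ) k2 hw hs
    (by rw [div_self hw.ne']; simp; positivity)
  have l3 := mul_ratio_le k3 hw hs (tU1.trans eζ)
  have l4 := mul_ratio_le k4 hw hs tU2
  rw [← hF _ (by omega), ← hF y (by omega)] at l0 l1 l3 l4
  rw [← hF y (by omega)] at l2
  have hF0 := limitOutput_nonneg A y
  set F := limitOutput A y
  set T := |(output P).real {y - 2 * j} - limitOutput A (y - 2 * j)|
        + |(output P).real {y - j} - limitOutput A (y - j)|
        + |(output P).real {y} - F|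
        + |(output P).real {y + j} - limitOutput A (y + j)|
        + |(output P).real {y + 2 * j} - limitOutput A (y + 2 * j)| with hT
  have hT0 : 0 ≤ T := by positivity
  -- Constants: five coefficients of size at most 3M², each with ratio error 2ζa⁴, give 30; the same
  -- coefficients times ratios of at most 3a⁴ give 9.
  calc P.real {x} * weight x y
      ≤ F * ((r ^ 2 * a ^ 4 + 2 * q * r * a + (q ^ 2 + 2 * p * r) + 2 * p * q * a
          + p ^ 2 * a ^ 4) + 30 * (M ^ 2 * a ^ 4) * ζ) + 9 * (M ^ 2 * a ^ 4) * T := by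
        refine hmain.trans ?_
        rw [hT]
        linarith
    _ ≤ _ := by gcongr

end PoissonChannel

namespace PoissonChannel

/-! ### A uniform bound on the atoms of the joint law -/

lemma tsum_ite_sub_le (g : ℕ → ℝ≥0∞) (k : ℕ) :
    ∑' y, (if k ≤ y then g (y - k) else 0) ≤ ∑' y, g y := by
  rw [← (add_left_injective k).tsum_eq (f := fun y => if k ≤ y then g (y - k) else 0)]
  · exact ENNReal.tsum_le_tsum fun y => by simp
  · intro y hy
    by_cases h : k ≤ y
    · exact ⟨y - k, Nat.sub_add_cancel h⟩
    · simp [h] at hy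

lemma tsum_add_le (g : ℕ → ℝ≥0∞) (k : ℕ) : ∑' y, g (y + k) ≤ ∑' y, g y :=
  ENNReal.tsum_comp_le_tsum_of_injective (add_left_injective k) g

/-- The outputs at distance `2 * j` from the edges `δ A` and `A`. -/
def IsBulk (δ : ℝ) (A : ℝ≥0) (j y : ℕ) : Prop := δ * A ≤ y ∧ ((y + 2 * j : ℕ) : ℝ) < A

-- The lower edge has mass at most √(2δ) by the partial sums of the weights. At the upper edge there
-- are at most 2j outputs, and `hj` puts them above A/4, where each mass is at most 1/A.
open Classical in
lemma tsum_limitOutput_not_isBulk_le {δ : ℝ} (hδ : 0 < δ) {A : ℝ≥0} (hA : 1 ≤ δ * A)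
    {j : ℕ} (hj : (2 * j : ℝ) ≤ 3 / 4 * A) :
    ∑' y, (if IsBulk δ A j y then 0 else ENNReal.ofReal (limitOutput A y)) ≤
      ENNReal.ofReal (√(2 * δ) + 2 * j / A) := by
  have hA0 : (0 : ℝ) < A := by
    by_contra h
    have : (A : ℝ) = 0 := le_antisymm (not_lt.1 h) A.coe_nonneg
    rw [this] at hA; linarith
  set s := Finset.range ⌈δ * (A : ℝ)⌉₊ with hs
  set t := Finset.Ico (⌈(A : ℝ)⌉₊ - 2 * j) ⌈(A : ℝ)⌉₊ with ht
  have hpt : ∀ y, (if IsBulk δ A j y then 0 else ENNReal.ofReal (limitOutput A y)) ≤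
      (if y ∈ s then ENNReal.ofReal (refWeight y / √A) else 0)
        + (if y ∈ t then ENNReal.ofReal (1 / A) else 0) := by
    intro y
    by_cases hb : IsBulk δ A j y
    · simp [hb]
    rw [if_neg hb]
    by_cases hyA : (y : ℝ) < A
    swap
    · simp [limitOutput, hyA]
    rw [limitOutput, if_pos hyA]
    by_cases hy : y ∈ s
    · rw [if_pos hy]; exact le_self_add
    have hy2 : δ * A ≤ y := by
      rw [hs, Finset.mem_range, Nat.lt_ceil, not_lt] at hy; exact hy
    have hy3 : (A : ℝ) ≤ ((y + 2 * j : ℕ) : ℝ) := by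
      by_contra h
      exact hb ⟨hy2, not_le.1 h⟩
    have hyt : y ∈ t := by
      rw [ht, Finset.mem_Ico, tsub_le_iff_right]
      exact ⟨Nat.ceil_le.2 hy3, Nat.lt_ceil.2 hyA⟩
    rw [if_neg hy, if_pos hyt, zero_add]
    refine ENNReal.ofReal_le_ofReal ?_
    push_cast at hy3
    have h4 : √(A : ℝ) ≤ 2 * √((y : ℝ) + 1) := by
      refine Real.sqrt_le_iff.2 ⟨by positivity, ?_⟩
      rw [mul_pow, Real.sq_sqrt (by positivity)]
      linarith
    rw [refWeight, div_div]
    refine one_div_le_one_div_of_le hA0 ?_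
    calc (A : ℝ) = √A * √A := (Real.mul_self_sqrt hA0.le).symm
      _ ≤ _ := by gcongr
  refine (ENNReal.tsum_le_tsum hpt).trans ?_
  rw [ENNReal.tsum_add]
  have e1 : ∑' y, (if y ∈ s then ENNReal.ofReal (refWeight y / √A) else 0) =
      ENNReal.ofReal (∑ y ∈ s, refWeight y / √A) := by
    rw [tsum_eq_sum (s := s) fun y hy => if_neg hy,
      ENNReal.ofReal_sum_of_nonneg fun y _ => div_nonneg (refWeight_pos y).le (Real.sqrt_nonneg _)]
    exact Finset.sum_congr rfl fun y hy => if_pos hy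
  have e2 : ∑' y, (if y ∈ t then ENNReal.ofReal (1 / (A : ℝ)) else 0) ≤
      ENNReal.ofReal (2 * j / A) := by
    rw [tsum_eq_sum (s := t) fun y hy => if_neg hy,
      Finset.sum_congr rfl fun y hy => if_pos hy, Finset.sum_const, nsmul_eq_mul]
    have hcard : t.card ≤ 2 * j := by rw [ht, Nat.card_Ico]; omega
    rw [← ENNReal.ofReal_natCast, ← ENNReal.ofReal_mul (by positivity)]
    refine ENNReal.ofReal_le_ofReal ?_
    have : (t.card : ℝ) ≤ 2 * j := by exact_mod_cast hcard
    rw [mul_one_div]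
    gcongr
  rw [e1, ENNReal.ofReal_add (by positivity) (by positivity)]
  refine add_le_add (ENNReal.ofReal_le_ofReal ?_) e2
  rw [← Finset.sum_div, div_le_iff₀ (by positivity), ← Real.sqrt_mul (by positivity)]
  refine (sum_refWeight_le _).trans (Real.sqrt_le_sqrt ?_)
  have := (Nat.ceil_lt_add_one (show 0 ≤ δ * (A : ℝ) by positivity)).le
  linarith

lemma tsum_limitOutput_le {A : ℝ≥0} (hA : 0 < A) :
    ∑' y, ENNReal.ofReal (limitOutput A y) ≤ ENNReal.ofReal (1 + 1 / √A) := by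
  have hA0 : (0 : ℝ) < A := hA
  rw [tsum_limitOutput]
  refine ENNReal.ofReal_le_ofReal ?_
  have h1 : √(A : ℝ) ≠ 0 := by positivity
  rw [div_le_iff₀ (by positivity), add_mul, one_mul, one_div_mul_cancel h1]
  refine (sum_refWeight_le _).trans (Real.sqrt_le_iff.2 ⟨by positivity, ?_⟩)
  have := (Nat.ceil_lt_add_one hA0.le).le
  nlinarith [Real.sq_sqrt hA0.le, Real.sqrt_nonneg (A : ℝ)]

lemma singleton_mul_le_output (P : Measure ℝ≥0) [IsProbabilityMeasure P] (x : ℝ≥0) (y : ℕ) :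
    P {x} * ENNReal.ofReal (weight x y) ≤ output P {y} := by
  rw [output_singleton, mul_comm]
  calc _ = ∫⁻ x' in {x}, ENNReal.ofReal (weight x' y) ∂P := by rw [lintegral_singleton]
    _ ≤ _ := setLIntegral_le_lintegral _ _

/-- If the atoms of the joint law are bounded in the bulk by a multiple of `limitOutput` up to
shifts of the total variation error, they have a summable bound. -/
lemma exists_bound_of_isBulk (P : Measure ℝ≥0) [IsProbabilityMeasure P] {A : ℝ≥0} (hA : 0 < A)
    {δ κ K τ b : ℝ} (hκ : 0 ≤ κ) (hK : 0 ≤ K) (hτ : 0 ≤ τ) {j : ℕ} (hb0 : 0 ≤ b)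
    (hbad : ∑' y, (open Classical in if IsBulk δ A j y then 0 else
      ENNReal.ofReal (limitOutput A y)) ≤ ENNReal.ofReal b)
    (hTV : ∑' y, ENNReal.ofReal |(output P).real {y} - limitOutput A y| ≤ ENNReal.ofReal τ)
    (hbulk : ∀ y, IsBulk δ A j y → 2 * j ≤ y ∧ ∀ x, P.real {x} * weight x y ≤
      limitOutput A y * κ +
      K * (|(output P).real {y - 2 * j} - limitOutput A (y - 2 * j)|
        + |(output P).real {y - j} - limitOutput A (y - j)|
        + |(output P).real {y} - limitOutput A y|
        + |(output P).real {y + j} - limitOutput A (y + j)|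
        + |(output P).real {y + 2 * j} - limitOutput A (y + 2 * j)|)) :
    ∃ B : ℕ → ℝ≥0∞, (∀ x y, P {x} * ENNReal.ofReal (weight x y) ≤ B y) ∧
      ∑' y, B y ≤ ENNReal.ofReal (b + τ + κ * (1 + 1 / √A) + K * (5 * τ)) := by
  classical
  set g : ℕ → ℝ≥0∞ := fun y => ENNReal.ofReal |(output P).real {y} - limitOutput A y| with hg
  -- Outside the bulk an atom is bounded by the whole output probability, hence by the limit law
  -- plus one total variation term. In the bulk the pointwise estimate is used, and each of its five
  -- shifted errors sums to at most τ.
  let B : ℕ → ℝ≥0∞ := fun y =>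
    (if IsBulk δ A j y then 0 else ENNReal.ofReal (limitOutput A y)) + g y
      + ENNReal.ofReal κ * ENNReal.ofReal (limitOutput A y)
      + ENNReal.ofReal K * ((if 2 * j ≤ y then g (y - 2 * j) else 0)
        + (if j ≤ y then g (y - j) else 0) + g y + g (y + j) + g (y + 2 * j))
  refine ⟨B, fun x y => ?_, ?_⟩
  · by_cases hb : IsBulk δ A j y
    · obtain ⟨hjy, hx⟩ := hbulk y hb
      have hP : P {x} * ENNReal.ofReal (weight x y) =
          ENNReal.ofReal (P.real {x} * weight x y) := by
        rw [ENNReal.ofReal_mul measureReal_nonneg, ofReal_measureReal]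
      have hF := limitOutput_nonneg A y
      rw [hP]
      refine (ENNReal.ofReal_le_ofReal (hx x)).trans ?_
      rw [ENNReal.ofReal_add (by positivity) (by positivity), ENNReal.ofReal_mul hF,
        ENNReal.ofReal_mul hK, ENNReal.ofReal_add (by positivity) (by positivity),
        ENNReal.ofReal_add (by positivity) (by positivity),
        ENNReal.ofReal_add (by positivity) (by positivity),
        ENNReal.ofReal_add (by positivity) (by positivity)]
      simp only [B]
      rw [if_pos hjy, if_pos (show j ≤ y by omega), if_pos hb, zero_add,
        mul_comm (ENNReal.ofReal (limitOutput A y))]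
      gcongr
      exact le_add_left le_rfl
    · refine (singleton_mul_le_output P x y).trans ?_
      simp only [B]
      rw [if_neg hb, add_assoc]
      refine le_trans ?_ le_self_add
      rw [hg, ← ENNReal.ofReal_add (limitOutput_nonneg A y) (abs_nonneg _),
        ← ofReal_measureReal]
      refine ENNReal.ofReal_le_ofReal ?_
      linarith [le_abs_self ((output P).real {y} - limitOutput A y)]
  · simp only [B]
    rw [ENNReal.tsum_add, ENNReal.tsum_add, ENNReal.tsum_add, ENNReal.tsum_mul_left,
      ENNReal.tsum_mul_left, ENNReal.tsum_add, ENNReal.tsum_add, ENNReal.tsum_add,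
      ENNReal.tsum_add, ENNReal.ofReal_add (by positivity) (by positivity),
      ENNReal.ofReal_add (by positivity) (by positivity), ENNReal.ofReal_add hb0 hτ,
      ENNReal.ofReal_mul hκ, ENNReal.ofReal_mul hK]
    have h5 : ENNReal.ofReal (5 * τ) = ENNReal.ofReal τ + ENNReal.ofReal τ + ENNReal.ofReal τ
        + ENNReal.ofReal τ + ENNReal.ofReal τ := by
      rw [← ENNReal.ofReal_add hτ hτ, ← ENNReal.ofReal_add (by positivity) hτ,
        ← ENNReal.ofReal_add (by positivity) hτ, ← ENNReal.ofReal_add (by positivity) hτ]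
      congr 1; ring
    rw [h5]
    gcongr
    · exact tsum_limitOutput_le hA
    · exact (tsum_ite_sub_le g _).trans hTV
    · exact (tsum_ite_sub_le g _).trans hTV
    · exact (tsum_add_le g _).trans hTV
    · exact (tsum_add_le g _).trans hTV

set_option maxHeartbeats 1000000 in
/-- The pointwise bulk estimate, at the scale `j ≈ h √A`. -/
lemma real_singleton_mul_weight_le_of_isBulk {P : Measure ℝ≥0} [IsProbabilityMeasure P]
    {A : ℝ≥0} {η δ h e B Z s : ℝ} {j y : ℕ} (hA0 : (0 : ℝ) < A) (hη0 : 0 < η) (hη1 : η ≤ 1 / 10)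
    (hδ0 : 0 < δ) (hh0 : 0 < h) (hhsq : h ^ 2 = δ * Real.log (1 + η)) (he0 : 0 < e)
    (he1 : e ≤ 1) (he2 : e ≤ (h ^ 2 / 8) ^ 2 / 2) (hB : (3 / e) ^ 2 * 16 = B)
    (hZ : 2 * h / δ + 16 * h ^ 3 / δ ^ 2 = Z) (hs0 : 0 < s) (hsA : s ^ 2 = A)
    (h2 : 4 * h ≤ s * δ) (h3 : Z ≤ s) (h4 : 30 * B * Z ≤ s * η)
    (hj0 : 0 < j) (hjle : (j : ℝ) ≤ h * s) (hjge : h * s / 2 ≤ j) (hy : IsBulk δ A j y) :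
    2 * j ≤ y ∧ ∀ x, P.real {x} * weight x y ≤
      limitOutput A y * (2 / 3 + 2 * η) +
      9 * B * (|(output P).real {y - 2 * j} - limitOutput A (y - 2 * j)|
        + |(output P).real {y - j} - limitOutput A (y - j)|
        + |(output P).real {y} - limitOutput A y|
        + |(output P).real {y + j} - limitOutput A (y + j)|
        + |(output P).real {y + 2 * j} - limitOutput A (y + 2 * j)|) := by
  obtain ⟨hy1, hy2⟩ := hy
  have hB0 : 0 ≤ B := by rw [← hB]; positivity
  have hy0 : (0 : ℝ) < y := lt_of_lt_of_le (by positivity) hy1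
  have hyA : (y : ℝ) ≤ A := by
    refine le_trans ?_ hy2.le
    push_cast; linarith [(Nat.cast_nonneg j : (0 : ℝ) ≤ j)]
  have h4j : 4 * j ≤ y := by
    have : (4 * j : ℝ) ≤ y := by
      refine le_trans ?_ hy1
      calc (4 * j : ℝ) ≤ 4 * h * s := by linarith
        _ ≤ s * δ * s := by gcongr
        _ = δ * A := by rw [← hsA]; ring
    exact_mod_cast this
  refine ⟨by omega, fun x => ?_⟩
  obtain ⟨a, ha⟩ : ∃ a, a = Real.exp ((j : ℝ) ^ 2 / (2 * y)) := ⟨_, rfl⟩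
  have hlog0 : 0 < Real.log (1 + η) := Real.log_pos (by linarith)
  have hj2 : (j : ℝ) ^ 2 ≤ Real.log (1 + η) * y := by
    calc (j : ℝ) ^ 2 ≤ (h * s) ^ 2 := by gcongr
      _ = Real.log (1 + η) * (δ * A) := by rw [mul_pow, hhsq, hsA]; ring
      _ ≤ _ := by gcongr
  have ha2 : a ^ 2 ≤ 1 + η := by
    rw [ha, ← Real.exp_nat_mul, ← Real.le_log_iff_exp_le (by positivity)]
    push_cast
    rw [← mul_div_assoc, mul_div_mul_left _ _ two_ne_zero, div_le_iff₀ hy0]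
    exact hj2
  have ha0 : 0 < a := ha ▸ Real.exp_pos _
  have ha3 : a ≤ 2 := by nlinarith
  -- The parameter a stays away from 1 by an amount independent of A and y. This keeps e and B,
  -- hence the coefficients of the test polynomial, fixed as A grows.
  have ha4 : 1 + h ^ 2 / 8 ≤ a := by
    have h9 := Real.add_one_le_exp ((j : ℝ) ^ 2 / (2 * y))
    have h10 : h ^ 2 / 8 ≤ (j : ℝ) ^ 2 / (2 * y) := by
      rw [div_le_div_iff₀ (by norm_num) (by positivity)]
      have h11 : (h * s / 2) ^ 2 ≤ (j : ℝ) ^ 2 := by gcongr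
      have h12 : h ^ 2 * y ≤ h ^ 2 * A := by gcongr
      rw [← hsA] at h12
      linarith
    linarith
  have hh8 : 0 < h ^ 2 / 8 := by positivity
  have hea : e ≤ (a ^ 2 - 1) ^ 2 / 2 := by
    refine he2.trans ?_
    have : h ^ 2 / 8 ≤ a ^ 2 - 1 := by nlinarith
    gcongr
  have hBa : ((1 + a) / e) ^ 2 * a ^ 4 ≤ B := by
    rw [← hB]
    have h16 : a ^ 4 ≤ 16 := by
      calc a ^ 4 ≤ 2 ^ 4 := by gcongr
        _ = 16 := by norm_num
    have h17 : (1 + a) / e ≤ 3 / e := by gcongr; linarith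
    gcongr
  have hζ : 2 * (j : ℝ) / y + 16 * j ^ 3 / y ^ 2 ≤ Z / s := by
    calc 2 * (j : ℝ) / y + 16 * j ^ 3 / y ^ 2
        ≤ 2 * (h * s) / (δ * A) + 16 * (h * s) ^ 3 / (δ * A) ^ 2 := by gcongr
      _ = Z / s := by rw [← hZ, ← hsA]; field_simp
  have hζ1 : Z / s ≤ 1 := by rw [div_le_one hs0]; exact h3
  have hmain := real_singleton_mul_weight_le P hj0 h4j hy2 ha he0 he1 hea hBa
    hζ hζ1 x
  refine hmain.trans ?_
  have hκ : (a ^ 2 + 1) / (a ^ 2 + 2) + 30 * B * (Z / s) ≤ 2 / 3 + 2 * η := by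
    have h13 : (a ^ 2 + 1) / (a ^ 2 + 2) ≤ 2 / 3 + η := by
      rw [div_le_iff₀ (by positivity)]
      have : (2 / 3 : ℝ) * (a ^ 2 + 2) + η * 2 ≤ (2 / 3 + η) * (a ^ 2 + 2) := by
        linarith [mul_nonneg hη0.le (sq_nonneg a)]
      linarith
    have h14 : 30 * B * (Z / s) ≤ η := by
      rw [← mul_div_assoc, div_le_iff₀ hs0]; linarith
    linarith
  have hF0 := limitOutput_nonneg A y
  gcongr

-- The order of choice matters. First η fixes the edge width δ, with √(2δ) = η, and the scale h,
-- with a² ≤ 1 + η in the bulk. These fix the coefficient bound B, and only then is the total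
-- variation τ chosen small against B. The discretization error Z/√A and the edge terms vanish as A
-- grows.
set_option maxHeartbeats 1000000 in
lemma eventually_exists_bound {c : ℝ} (hc : 2 / 3 < c) :
    ∀ᶠ A : ℝ≥0 in Filter.atTop, ∀ P, IsCapacityAchieving A P →
      ∃ B : ℕ → ℝ≥0∞, (∀ x y, P {x} * ENNReal.ofReal (weight x y) ≤ B y) ∧
        ∑' y, B y ≤ ENNReal.ofReal c := by
  set η : ℝ := min (1 / 10) ((c - 2 / 3) / 8) with hη
  have hη0 : 0 < η := lt_min (by norm_num) (by linarith)
  have hη1 : η ≤ 1 / 10 := min_le_left _ _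
  have hη2 : η ≤ (c - 2 / 3) / 8 := min_le_right _ _
  set δ : ℝ := η ^ 2 / 2 with hδ
  have hδ0 : 0 < δ := by positivity
  have hlog0 : 0 < Real.log (1 + η) := Real.log_pos (by linarith)
  set h : ℝ := √(δ * Real.log (1 + η)) with hh
  have hh0 : 0 < h := by positivity
  have hhsq : h ^ 2 = δ * Real.log (1 + η) := Real.sq_sqrt (by positivity)
  set e : ℝ := min 1 ((h ^ 2 / 8) ^ 2 / 2) with he
  have he0 : 0 < e := by positivity
  set B : ℝ := (3 / e) ^ 2 * 16 with hB
  have hB0 : 0 < B := by positivity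
  set Z : ℝ := 2 * h / δ + 16 * h ^ 3 / δ ^ 2 with hZ
  have hZ0 : 0 < Z := by positivity
  -- Makes τ + 9B · 5τ = η: one error outside the bulk plus five shifted ones inside.
  set τ : ℝ := η / (1 + 45 * B) with hτ
  have hτ0 : 0 < τ := by positivity
  have hsqrt : Filter.Tendsto (fun A : ℝ≥0 => √(A : ℝ)) Filter.atTop Filter.atTop :=
    Real.tendsto_sqrt_atTop.comp (NNReal.tendsto_coe_atTop.2 Filter.tendsto_id)
  filter_upwards [eventually_tsum_abs_output_sub_le hτ0, Filter.eventually_gt_atTop 0,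
    hsqrt.eventually_ge_atTop (2 / h), hsqrt.eventually_ge_atTop (4 * h / δ),
    hsqrt.eventually_ge_atTop Z, hsqrt.eventually_ge_atTop (30 * B * Z / η),
    hsqrt.eventually_ge_atTop (1 / η), hsqrt.eventually_ge_atTop (2 * h / η),
    hsqrt.eventually_ge_atTop (4 * h), hsqrt.eventually_ge_atTop (1 / δ),
    hsqrt.eventually_ge_atTop 1]
    with A hTV hA h1 h2 h3 h4 h5 h6 h7 h8 h9 P hP
  have := hP.admissible.isProbabilityMeasure
  have hA0 : (0 : ℝ) < A := hA
  set s := √(A : ℝ) with hs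
  have hs0 : 0 < s := by positivity
  have hsA : s ^ 2 = A := Real.sq_sqrt hA0.le
  rw [div_le_iff₀ hh0] at h1
  rw [div_le_iff₀ hδ0] at h2 h8
  rw [div_le_iff₀ hη0] at h4 h5 h6
  set j : ℕ := ⌊h * s⌋₊ with hj
  have hjle : (j : ℝ) ≤ h * s := Nat.floor_le (by positivity)
  have hjge : h * s / 2 ≤ j := by
    have := Nat.lt_floor_add_one (h * s)
    rw [← hj] at this
    linarith
  have hj0 : 0 < j := by
    have : (0 : ℝ) < j := lt_of_lt_of_le (by positivity) hjge
    exact_mod_cast this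
  have hbad := tsum_limitOutput_not_isBulk_le (A := A) hδ0 (j := j)
    (by
      rw [← hsA]
      calc (1 : ℝ) = 1 * 1 := (one_mul 1).symm
        _ ≤ (s * δ) * s := mul_le_mul h8 h9 zero_le_one (by positivity)
        _ = δ * s ^ 2 := by ring)
    (by
      rw [← hsA]
      calc 2 * (j : ℝ) ≤ 2 * (h * s) := by gcongr
        _ = 4 * h * s / 2 := by ring
        _ ≤ s * s / 2 := by gcongr
        _ ≤ 3 / 4 * s ^ 2 := by linarith [sq_nonneg s])
  have hb1 : √(2 * δ) = η := by
    rw [hδ, mul_div_cancel₀ _ two_ne_zero, Real.sqrt_sq hη0.le]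
  have hb2 : 2 * (j : ℝ) / A ≤ η := by
    rw [div_le_iff₀ hA0, ← hsA]
    calc 2 * (j : ℝ) ≤ 2 * h * s := by linarith
      _ ≤ s * η * s := by gcongr
      _ = η * s ^ 2 := by ring
  rw [hb1] at hbad
  obtain ⟨F, hF1, hF2⟩ := exists_bound_of_isBulk P hA (κ := 2 / 3 + 2 * η) (K := 9 * B)
    (by positivity) (by positivity) hτ0.le (by positivity) hbad (hTV P hP) (fun y hy =>
      real_singleton_mul_weight_le_of_isBulk hA0 hη0 hη1 hδ0 hh0 hhsq he0 (min_le_left _ _)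
        (min_le_right _ _) rfl rfl hs0 hsA (by linarith) h3 (by linarith) hj0 hjle hjge hy)
  refine ⟨F, hF1, hF2.trans (ENNReal.ofReal_le_ofReal ?_)⟩
  have h9 : 1 / s ≤ η := by rw [div_le_iff₀ hs0]; linarith
  have h10 : τ + 9 * B * (5 * τ) = η := by rw [hτ]; field_simp; ring
  have h11 : (2 / 3 + 2 * η) * (1 + 1 / s) ≤ (2 / 3 + 2 * η) * (1 + η) := by gcongr
  nlinarith

end PoissonChannel

namespace PoissonChannel

/-! ### Error probability and equivocation -/

section Bound

variable {P : Measure ℝ≥0} {B : ℕ → ℝ≥0∞} {c : ℝ}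

lemma joint_inter (P : Measure ℝ≥0) [IsProbabilityMeasure P] (x : ℝ≥0) (y : ℕ) :
    joint P (Prod.snd ⁻¹' {y} ∩ Prod.fst ⁻¹' {x}) = P {x} * ENNReal.ofReal (weight x y) := by
  have : (Prod.snd ⁻¹' {y} ∩ Prod.fst ⁻¹' {x} : Set (ℝ≥0 × ℕ)) = {x} ×ˢ {y} := by
    ext p; simp [and_comm, Prod.ext_iff]
  rw [this, joint, Measure.compProd_apply_prod (measurableSet_singleton _)
    (measurableSet_singleton _), lintegral_singleton, channel_apply,
    poissonMeasure_singleton_eq, mul_comm]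

lemma posteriorProb_eq (P : Measure ℝ≥0) [IsProbabilityMeasure P] (x : ℝ≥0) (y : ℕ) :
    posteriorProb P x y = (output P {y})⁻¹ * (P {x} * ENNReal.ofReal (weight x y)) := by
  rw [posteriorProb, cond_apply (measurable_snd (measurableSet_singleton y)), joint_inter,
    output, Measure.map_apply measurable_snd (measurableSet_singleton y)]

lemma posteriorProb_le_one (P : Measure ℝ≥0) (x : ℝ≥0) (y : ℕ) : posteriorProb P x y ≤ 1 :=
  prob_le_one

/-- A decoder picks a single input for each output, so the event of correct decoding is a union of
one joint atom per output. -/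
lemma one_sub_le_errorProb [IsProbabilityMeasure P]
    (hB : ∀ x y, P {x} * ENNReal.ofReal (weight x y) ≤ B y)
    (hc : ∑' y, B y ≤ ENNReal.ofReal c) (Xhat : ℕ → ℝ≥0) :
    1 - ENNReal.ofReal c ≤ errorProb P Xhat := by
  have hm : MeasurableSet {p : ℝ≥0 × ℕ | p.1 = Xhat p.2} :=
    measurableSet_eq_fun measurable_fst ((measurable_of_countable Xhat).comp measurable_snd)
  have h1 : joint P {p | p.1 = Xhat p.2} ≤ ENNReal.ofReal c := by
    have : {p : ℝ≥0 × ℕ | p.1 = Xhat p.2} ⊆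
        ⋃ y, (Prod.snd ⁻¹' {y} ∩ Prod.fst ⁻¹' {Xhat y}) := by
      intro p hp
      exact Set.mem_iUnion.2 ⟨p.2, rfl, hp⟩
    refine (measure_mono this).trans ((measure_iUnion_le _).trans (le_trans ?_ hc))
    exact ENNReal.tsum_le_tsum fun y => (joint_inter P _ _).trans_le (hB _ _)
  have h2 : errorProb P Xhat = 1 - joint P {p | p.1 = Xhat p.2} :=
    prob_compl_eq_one_sub hm
  rw [h2]
  exact tsub_le_tsub_left h1 1

lemma lintegral_output_inv_mul_le [IsProbabilityMeasure P]
    (hc : ∑' y, B y ≤ ENNReal.ofReal c) :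
    ∫⁻ p, (output P {p.2})⁻¹ * B p.2 ∂(joint P) ≤ ENNReal.ofReal c := by
  calc ∫⁻ p, (output P {p.2})⁻¹ * B p.2 ∂(joint P)
      = ∫⁻ y, (output P {y})⁻¹ * B y ∂(output P) := by
        rw [output, lintegral_map (measurable_of_countable _) measurable_snd]
    _ = ∑' y, (output P {y})⁻¹ * B y * output P {y} := lintegral_countable' _
    _ ≤ ∑' y, B y := by
        refine ENNReal.tsum_le_tsum fun y => ?_
        rw [mul_right_comm]
        exact mul_le_of_le_one_left zero_le (ENNReal.inv_mul_le_one _)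
    _ ≤ _ := hc

/-- Tangent line bound for `- log`. -/
lemma one_sub_log_le {p : ℝ≥0∞} (hp : p ≤ 1) (hc : 0 < c) :
    ENNReal.ofReal (1 - Real.log c) ≤ (- ENNReal.log p).toENNReal + (ENNReal.ofReal c)⁻¹ * p := by
  rcases eq_or_ne p 0 with rfl | h0
  · simp
  lift p to ℝ≥0 using ne_top_of_le_ne_top ENNReal.one_ne_top hp
  have hp0 : (p : ℝ) ≠ 0 := by simpa using h0
  have hpos : (0 : ℝ) < p := lt_of_le_of_ne p.coe_nonneg hp0.symm
  have hp1 : (p : ℝ) ≤ 1 := by exact_mod_cast hp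
  rw [ENNReal.log_of_nnreal (by simpa using h0), ← EReal.coe_neg, EReal.toENNReal_of_ne_top
    (EReal.coe_ne_top _), EReal.toReal_coe, ← ENNReal.ofReal_coe_nnreal, ← ENNReal.ofReal_inv_of_pos hc,
    ← ENNReal.ofReal_mul (by positivity), ← ENNReal.ofReal_add
      (neg_nonneg.2 (Real.log_nonpos hpos.le hp1)) (by positivity)]
  refine ENNReal.ofReal_le_ofReal ?_
  have := Real.log_le_sub_one_of_pos (show 0 < c⁻¹ * p by positivity)
  rw [Real.log_mul (by positivity) hp0, Real.log_inv] at this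
  linarith

/-- Jensen's inequality in tangent form: -log p ≥ 1 - log c - p/c, and the mean posterior
probability is at most ∑ y, B y ≤ c, so the linear term costs at most 1. -/
lemma neg_log_le_equivocation [IsProbabilityMeasure P]
    (hB : ∀ x y, P {x} * ENNReal.ofReal (weight x y) ≤ B y)
    (hc : ∑' y, B y ≤ ENNReal.ofReal c) (hc0 : 0 < c) (hc1 : c ≤ 1) :
    ENNReal.ofReal (- Real.log c) ≤ equivocation P := by
  have h : ENNReal.ofReal (1 - Real.log c) ≤ equivocation P + 1 := by
    calc ENNReal.ofReal (1 - Real.log c)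
        = ∫⁻ _, ENNReal.ofReal (1 - Real.log c) ∂(joint P) := by simp
      _ ≤ ∫⁻ p, ((- ENNReal.log (posteriorProb P p.1 p.2)).toENNReal
            + (ENNReal.ofReal c)⁻¹ * ((output P {p.2})⁻¹ * B p.2)) ∂(joint P) := by
          refine lintegral_mono fun p => (one_sub_log_le (posteriorProb_le_one P p.1 p.2) hc0).trans ?_
          gcongr
          rw [posteriorProb_eq]
          gcongr
          exact hB _ _
      _ = equivocation P
            + (ENNReal.ofReal c)⁻¹ * ∫⁻ p, (output P {p.2})⁻¹ * B p.2 ∂(joint P) := by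
          have hm : Measurable fun p : ℝ≥0 × ℕ => (output P {p.2})⁻¹ * B p.2 :=
            (measurable_of_countable fun y => (output P {y})⁻¹ * B y).comp measurable_snd
          rw [lintegral_add_right _ (hm.const_mul _), lintegral_const_mul _ hm, equivocation]
      _ ≤ equivocation P + (ENNReal.ofReal c)⁻¹ * ENNReal.ofReal c := by
          gcongr
          exact lintegral_output_inv_mul_le hc
      _ = _ := by
          rw [ENNReal.inv_mul_cancel (by simpa using hc0) ENNReal.ofReal_ne_top]
  rw [sub_eq_neg_add, ENNReal.ofReal_add (neg_nonneg.2 (Real.log_nonpos hc0.le hc1)) zero_le_one,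
    ENNReal.ofReal_one] at h
  exact (ENNReal.add_le_add_iff_right ENNReal.one_ne_top).1 h

end Bound

lemma lt_sqrt_two_div_pi : 0.79785 < √(2 / Real.pi) := by
  refine Real.lt_sqrt_of_sq_lt ?_
  rw [lt_div_iff₀ Real.pi_pos]
  nlinarith [Real.pi_lt_d4]

lemma log_le_neg_of_near_two_thirds : Real.log 0.667 ≤ - 0.4043 := by
  rw [Real.log_le_iff_le_exp (by norm_num)]
  have h := Real.exp_bound (x := -0.4043) (by norm_num [abs_le]) (n := 6) (by norm_num)
  have h' := (abs_le.1 h).1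
  norm_num [Finset.sum_range_succ, Nat.factorial, abs_of_neg, abs_of_pos] at h' ⊢
  linarith

end PoissonChannel

theorem mainTheorem4 (PX : ℝ≥0 → Measure ℝ≥0)
    (hPX : ∀ A : ℝ≥0, 0 < A → PoissonChannel.IsCapacityAchieving A (PX A)) :
    (∀ Xhat : ℝ≥0 → ℕ → ℝ≥0,
      (∀ A : ℝ≥0, 0 < A → PoissonChannel.IsMAPDecoder (PX A) (Xhat A)) →
      ENNReal.ofReal (1 - √(2 / Real.pi)) ≤
        Filter.liminf (fun A : ℝ≥0 => PoissonChannel.errorProb (PX A) (Xhat A)) Filter.atTop) ∧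
    ENNReal.ofReal (2 * (1 - √(2 / Real.pi))) ≤
      Filter.liminf (fun A : ℝ≥0 => PoissonChannel.equivocation (PX A)) Filter.atTop := by
  -- The value must exceed 2/3 and stay below exp(-2(1 - √(2/π))) ≈ 0.66749. The equivocation is the
  -- tight constraint; the error probability leaves ample room.
  have hB := PoissonChannel.eventually_exists_bound (c := 0.667) (by norm_num)
  have hpi := PoissonChannel.lt_sqrt_two_div_pi
  refine ⟨fun Xhat _ => ?_, ?_⟩
  · refine Filter.le_liminf_of_le (by isBoundedDefault) ?_
    filter_upwards [hB, Filter.eventually_gt_atTop 0] with A hA hA0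
    obtain ⟨B, hB1, hB2⟩ := hA _ (hPX A hA0)
    have := (hPX A hA0).admissible.isProbabilityMeasure
    refine le_trans ?_ (PoissonChannel.one_sub_le_errorProb hB1 hB2 (Xhat A))
    rw [← ENNReal.ofReal_one, ← ENNReal.ofReal_sub _ (by norm_num)]
    exact ENNReal.ofReal_le_ofReal (by linarith)
  · refine Filter.le_liminf_of_le (by isBoundedDefault) ?_
    filter_upwards [hB, Filter.eventually_gt_atTop 0] with A hA hA0
    obtain ⟨B, hB1, hB2⟩ := hA _ (hPX A hA0)
    have := (hPX A hA0).admissible.isProbabilityMeasure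
    refine le_trans (ENNReal.ofReal_le_ofReal ?_)
      (PoissonChannel.neg_log_le_equivocation hB1 hB2 (by norm_num) (by norm_num))
    linarith [PoissonChannel.log_le_neg_of_near_two_thirds]
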